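/- Work in Martin-Löf dependent type theory with the types $\mathbf 0$, $\mathbf 1$, $\mathbb N$, $A+B$, $\prod_{x:A}B(x)$, $\sum_{x:A}B(x)$ and identity types, with function extensionality for types of any size, and with a univalent universe $\mathcal U$ that contains $\mathbf 0,\mathbf 1,\mathbb N$ and is closed under these type formers and under graph quotients. Here the graph quotient of a graph with vertices $V:\mathcal U$ and edges $E:V\to V\to\mathcal U$ is the higher inductive type with constructors $V\to \mathrm{colim}(V,E)$ and $\prod_{i,j:V}E(i,j)\to(\mathrm{pt}(i)=\mathrm{pt}(j))$, with induction into type families of any size. No propositional truncation is assumed. A type $P$ is a mere proposition if $\prod_{x,y:P}x=y$. A map $f:A\to X$ is an embedding if for every $x:X$ the fiber $\sum_{a:A}f(a)=x$ is a mere proposition. A map $f:A\to B$ is an equivalence if it has a left inverse and a right inverse up to homotopy. For $f:A\to X$ and $g:B\to X$, the type $A*_XB$ is the (homotopy) pushout of $A\xleftarrow{\pi_1}A\times_XB\xrightarrow{\pi_2}B$, where $A\times_XB=\sum_{a:A}\sum_{b:B}f(a)=g(b)$; the join $A*B$ of types is the pushout of $A\leftarrow A\times B\to B$; in both cases $\mathrm{inl}$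 is the inclusion of $A$. Pushouts are constructed from graph quotients, as homotopy coequalizers. **Theorem.** The following hold, i.e. the corresponding closed types have closed terms in this type theory. 1. For all $A,X:\mathcal U$ and every map $f:A\to X$, the following are logically equivalent: (i) $f$ is an embedding; (ii) $f$ is a canonical idempotent for the join operation on maps, in the sense that $\mathrm{inl}:A\to A*_XA$ is an equivalence. 2. For every $P:\mathcal U$, the following are logically equivalent: (i) $P$ is a mere proposition; (ii) $P$ is a canonical idempotent for the join operation on types, in the sense that $\mathrm{inl}:P\to P*P$ is an equivalence. -/

import Mathlib

/-!
# Martin-Löf type theory with a univalent universe closed under graph quotients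

The formal system in which the result lives: raw terms with de Bruijn indices, definitional
equality, and the inductively generated typing judgement.  "We have `T` in type theory" means
that some closed term of type `T` is derivable.
-/

namespace MLTT

/-- The two sizes: `small` types are the elements of the universe `𝒰`; `large` means any size. -/
inductive Size
  | small
  | large

/-- Raw terms (and types).  Variables are de Bruijn indices; the comments say how many variables
are bound in which argument. -/
inductive Tm
  | var (n : ℕ)
  /-- `sort small` is the universe `𝒰`.  `sort large` is not a type: the judgement
  `A : sort large` is the judgement "`A` is a type" (of any size). -/
  | sort (s : Size)
  /-- `Π (x : A), B x`; one variable is bound in `B` -/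
  | pi (A B : Tm)
  /-- `λ (x : A), t`; one variable is bound in `t` -/
  | lam (A t : Tm)
  | app (f a : Tm)
  /-- `Σ (x : A), B x`; one variable is bound in `B` -/
  | sig (A B : Tm)
  | pair (a b : Tm)
  /-- induction for `Σ`: motive `C` (binds 1), case `d` (binds 2) -/
  | sigInd (C d p : Tm)
  /-- disjoint sum -/
  | sum (A B : Tm)
  | inl (a : Tm)
  | inr (b : Tm)
  /-- induction for sums: motive `C` (binds 1), cases `l`, `r` (bind 1) -/
  | sumInd (C l r s : Tm)
  | empty
  /-- induction for the empty type: motive `C` (binds 1) -/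
  | emptyInd (C t : Tm)
  | unit
  | star
  /-- induction for the unit type: motive `C` (binds 1) -/
  | unitInd (C c t : Tm)
  | nat
  | zero
  | succ (n : Tm)
  /-- induction for `ℕ`: motive `C` (binds 1), step `s` (binds 2: the number and the hypothesis) -/
  | natInd (C z s n : Tm)
  /-- the identity type `a =_A b` -/
  | id (A a b : Tm)
  | refl (a : Tm)
  /-- (based) path induction: motive `C` (binds 2: the endpoint and the path), case `c`, path `p` -/
  | idInd (C c p : Tm)
  /-- the graph quotient of the graph with vertices `V` and edges `E` (binds 2) -/
  | gq (V E : Tm)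
  /-- the point constructor of graph quotients -/
  | gqPt (v : Tm)
  /-- the path constructor of graph quotients, at the edge `e` from `i` to `j` -/
  | gqEdge (i j e : Tm)
  /-- induction for graph quotients: motive `P` (binds 1), points `p` (binds 1),
  edges `q` (binds 3) -/
  | gqInd (P p q x : Tm)
  /-- the propositional computation rule of `gqInd` at the edge `e` from `i` to `j` -/
  | gqComp (P p q i j e : Tm)
  /-- function extensionality for `f g : Π (x : A), B x`; one variable is bound in `B` -/
  | funext (A B f g : Tm)
  /-- univalence of `𝒰` at `A B : 𝒰` -/
  | ua (A B : Tm)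

namespace Tm

/-- Lift a renaming under a binder. -/
def up (ρ : ℕ → ℕ) : ℕ → ℕ
  | 0 => 0
  | n + 1 => ρ n + 1

/-- Renaming of variables. -/
def rename (ρ : ℕ → ℕ) : Tm → Tm
  | var n => var (ρ n)
  | sort s => sort s
  | pi A B => pi (A.rename ρ) (B.rename (up ρ))
  | lam A t => lam (A.rename ρ) (t.rename (up ρ))
  | app f a => app (f.rename ρ) (a.rename ρ)
  | sig A B => sig (A.rename ρ) (B.rename (up ρ))
  | pair a b => pair (a.rename ρ) (b.rename ρ)
  | sigInd C d p => sigInd (C.rename (up ρ)) (d.rename (up (up ρ))) (p.rename ρ)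
  | sum A B => sum (A.rename ρ) (B.rename ρ)
  | inl a => inl (a.rename ρ)
  | inr b => inr (b.rename ρ)
  | sumInd C l r s =>
      sumInd (C.rename (up ρ)) (l.rename (up ρ)) (r.rename (up ρ)) (s.rename ρ)
  | empty => empty
  | emptyInd C t => emptyInd (C.rename (up ρ)) (t.rename ρ)
  | unit => unit
  | star => star
  | unitInd C c t => unitInd (C.rename (up ρ)) (c.rename ρ) (t.rename ρ)
  | nat => nat
  | zero => zero
  | succ n => succ (n.rename ρ)
  | natInd C z s n =>
      natInd (C.rename (up ρ)) (z.rename ρ) (s.rename (up (up ρ))) (n.rename ρ)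
  | id A a b => id (A.rename ρ) (a.rename ρ) (b.rename ρ)
  | refl a => refl (a.rename ρ)
  | idInd C c p => idInd (C.rename (up (up ρ))) (c.rename ρ) (p.rename ρ)
  | gq V E => gq (V.rename ρ) (E.rename (up (up ρ)))
  | gqPt v => gqPt (v.rename ρ)
  | gqEdge i j e => gqEdge (i.rename ρ) (j.rename ρ) (e.rename ρ)
  | gqInd P p q x =>
      gqInd (P.rename (up ρ)) (p.rename (up ρ)) (q.rename (up (up (up ρ)))) (x.rename ρ)
  | gqComp P p q i j e =>
      gqComp (P.rename (up ρ)) (p.rename (up ρ)) (q.rename (up (up (up ρ))))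
        (i.rename ρ) (j.rename ρ) (e.rename ρ)
  | funext A B f g => funext (A.rename ρ) (B.rename (up ρ)) (f.rename ρ) (g.rename ρ)
  | ua A B => ua (A.rename ρ) (B.rename ρ)

/-- Weakening by `k` variables. -/
def wk (k : ℕ) (t : Tm) : Tm := t.rename (fun n => n + k)

/-- Lift a substitution under a binder. -/
def ups (σ : ℕ → Tm) : ℕ → Tm
  | 0 => var 0
  | n + 1 => (σ n).wk 1

/-- Simultaneous (capture-avoiding) substitution. -/
def subst (σ : ℕ → Tm) : Tm → Tm
  | var n => σ n
  | sort s => sort s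
  | pi A B => pi (A.subst σ) (B.subst (ups σ))
  | lam A t => lam (A.subst σ) (t.subst (ups σ))
  | app f a => app (f.subst σ) (a.subst σ)
  | sig A B => sig (A.subst σ) (B.subst (ups σ))
  | pair a b => pair (a.subst σ) (b.subst σ)
  | sigInd C d p => sigInd (C.subst (ups σ)) (d.subst (ups (ups σ))) (p.subst σ)
  | sum A B => sum (A.subst σ) (B.subst σ)
  | inl a => inl (a.subst σ)
  | inr b => inr (b.subst σ)
  | sumInd C l r s =>
      sumInd (C.subst (ups σ)) (l.subst (ups σ)) (r.subst (ups σ)) (s.subst σ)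
  | empty => empty
  | emptyInd C t => emptyInd (C.subst (ups σ)) (t.subst σ)
  | unit => unit
  | star => star
  | unitInd C c t => unitInd (C.subst (ups σ)) (c.subst σ) (t.subst σ)
  | nat => nat
  | zero => zero
  | succ n => succ (n.subst σ)
  | natInd C z s n =>
      natInd (C.subst (ups σ)) (z.subst σ) (s.subst (ups (ups σ))) (n.subst σ)
  | id A a b => id (A.subst σ) (a.subst σ) (b.subst σ)
  | refl a => refl (a.subst σ)
  | idInd C c p => idInd (C.subst (ups (ups σ))) (c.subst σ) (p.subst σ)
  | gq V E => gq (V.subst σ) (E.subst (ups (ups σ)))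
  | gqPt v => gqPt (v.subst σ)
  | gqEdge i j e => gqEdge (i.subst σ) (j.subst σ) (e.subst σ)
  | gqInd P p q x =>
      gqInd (P.subst (ups σ)) (p.subst (ups σ)) (q.subst (ups (ups (ups σ)))) (x.subst σ)
  | gqComp P p q i j e =>
      gqComp (P.subst (ups σ)) (p.subst (ups σ)) (q.subst (ups (ups (ups σ))))
        (i.subst σ) (j.subst σ) (e.subst σ)
  | funext A B f g => funext (A.subst σ) (B.subst (ups σ)) (f.subst σ) (g.subst σ)
  | ua A B => ua (A.subst σ) (B.subst σ)

/-- The substitution sending variable `0` to `a` and variable `n + 1` to `σ n`. -/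
def scons (a : Tm) (σ : ℕ → Tm) : ℕ → Tm
  | 0 => a
  | n + 1 => σ n

/-- `shift k` weakens by `k` variables; `t.subst (scons a (shift k))` replaces the last variable
of `t` by `a`, where `a` lives in a context with `k` more variables. -/
def shift (k : ℕ) : ℕ → Tm := fun n => var (n + k)

/-- `t[a]` -/
def inst (t a : Tm) : Tm := t.subst (scons a (shift 0))

/-- `t[a, b]`, with `a` for variable `1` and `b` for variable `0` -/
def inst₂ (t a b : Tm) : Tm := t.subst (scons b (scons a (shift 0)))

/-- `t[a, b, c]`, with `a` for variable `2`, `b` for variable `1`, `c` for variable `0` -/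
def inst₃ (t a b c : Tm) : Tm := t.subst (scons c (scons b (scons a (shift 0))))

end Tm

open Tm

/-! ### Derived notions

In each of these abbreviations, all arguments live in one and the same context, except where
a binder is mentioned. -/

/-- The universe. -/
def U : Tm := sort .small

/-- `A → B` -/
def arrow (A B : Tm) : Tm := pi A (B.wk 1)

/-- `A × B` -/
def prod (A B : Tm) : Tm := sig A (B.wk 1)

/-- Logical equivalence `(A → B) × (B → A)`. -/
def iff (A B : Tm) : Tm := prod (arrow A B) (arrow B A)

/-- The identity function of `A`. -/
def idFun (A : Tm) : Tm := lam A (var 0)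

/-- Transport of `u : P a` along `p : a = b`, where `P` binds one variable. -/
def tr (P p u : Tm) : Tm := idInd (P.wk 1) u p

/-- The dependent action on the path `p : a = b` of the function `x ↦ F x : P x`, an element of
`tr P p (F a) = F b`; the terms `P` and `F` bind one variable. -/
def apd (P F a p : Tm) : Tm :=
  idInd (id (P.wk 1) (tr (P.rename (up (fun n => n + 2))) (var 0) ((F.inst a).wk 2)) (F.wk 1))
    (refl (F.inst a)) p

/-- `f : A → B` is an equivalence: `(Σ g, g ∘ f ∼ id) × (Σ h, f ∘ h ∼ id)`. -/
def isEquiv (A B f : Tm) : Tm :=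
  prod
    (sig (arrow B A)
      (pi (A.wk 1) (id (A.wk 2) (app (var 1) (app (f.wk 2) (var 0))) (var 0))))
    (sig (arrow B A)
      (pi (B.wk 1) (id (B.wk 2) (app (f.wk 2) (app (var 1) (var 0))) (var 0))))

/-- `A ≃ B` -/
def equiv (A B : Tm) : Tm := sig (arrow A B) (isEquiv (A.wk 1) (B.wk 1) (var 0))

/-- The identity function of `A` as an element of `A ≃ A`. -/
def idEquiv (A : Tm) : Tm :=
  pair (idFun A)
    (pair (pair (idFun A) (lam A (refl (var 0)))) (pair (idFun A) (lam A (refl (var 0)))))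

/-- The canonical map `(A = B) → (A ≃ B)`, for `A B : 𝒰`. -/
def idToEquiv (A B : Tm) : Tm :=
  lam (id U A B) (idInd (equiv (A.wk 3) (var 1)) (idEquiv (A.wk 1)) (var 0))

/-- The type `f ∼ g` of homotopies between `f g : Π (x : A), B x`; `B` binds one variable. -/
def htpy (A B f g : Tm) : Tm := pi A (id B (app (f.wk 1) (var 0)) (app (g.wk 1) (var 0)))

/-- The canonical map `(f = g) → (f ∼ g)`. -/
def happly (A B f g : Tm) : Tm :=
  lam (id (pi A B) f g)
    (idInd (htpy (A.wk 3) (B.rename (up (fun n => n + 3))) (f.wk 3) (var 1))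
      (lam (A.wk 1) (refl (app (f.wk 2) (var 0)))) (var 0))

/-! ### Definitional equality -/

/-- Definitional equality (conversion): the congruence generated by the computation rules.
No uniqueness rules (`η`) are included; having fewer definitional equalities makes derivability
a stronger claim. -/
inductive Conv : Tm → Tm → Prop
  | rfl (t) : Conv t t
  | symm {t u} : Conv t u → Conv u t
  | trans {t u v} : Conv t u → Conv u v → Conv t v
  -- computation rules
  | beta (A t a) : Conv (app (lam A t) a) (t.inst a)
  | sigInd_pair (C d a b) : Conv (sigInd C d (pair a b)) (d.inst₂ a b)
  | sumInd_inl (C l r a) : Conv (sumInd C l r (inl a)) (l.inst a)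
  | sumInd_inr (C l r b) : Conv (sumInd C l r (inr b)) (r.inst b)
  | unitInd_star (C c) : Conv (unitInd C c star) c
  | natInd_zero (C z s) : Conv (natInd C z s zero) z
  | natInd_succ (C z s n) : Conv (natInd C z s (succ n)) (s.inst₂ n (natInd C z s n))
  | idInd_refl (C c a) : Conv (idInd C c (refl a)) c
  | gqInd_pt (P p q v) : Conv (gqInd P p q (gqPt v)) (p.inst v)
  -- congruence rules
  | pi {A A' B B'} : Conv A A' → Conv B B' → Conv (pi A B) (pi A' B')
  | lam {A A' t t'} : Conv A A' → Conv t t' → Conv (lam A t) (lam A' t')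
  | app {f f' a a'} : Conv f f' → Conv a a' → Conv (app f a) (app f' a')
  | sig {A A' B B'} : Conv A A' → Conv B B' → Conv (sig A B) (sig A' B')
  | pair {a a' b b'} : Conv a a' → Conv b b' → Conv (pair a b) (pair a' b')
  | sigInd {C C' d d' p p'} :
      Conv C C' → Conv d d' → Conv p p' → Conv (sigInd C d p) (sigInd C' d' p')
  | sum {A A' B B'} : Conv A A' → Conv B B' → Conv (sum A B) (sum A' B')
  | inl {a a'} : Conv a a' → Conv (inl a) (inl a')
  | inr {b b'} : Conv b b' → Conv (inr b) (inr b')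
  | sumInd {C C' l l' r r' s s'} : Conv C C' → Conv l l' → Conv r r' → Conv s s' →
      Conv (sumInd C l r s) (sumInd C' l' r' s')
  | emptyInd {C C' t t'} : Conv C C' → Conv t t' → Conv (emptyInd C t) (emptyInd C' t')
  | unitInd {C C' c c' t t'} :
      Conv C C' → Conv c c' → Conv t t' → Conv (unitInd C c t) (unitInd C' c' t')
  | succ {n n'} : Conv n n' → Conv (succ n) (succ n')
  | natInd {C C' z z' s s' n n'} : Conv C C' → Conv z z' → Conv s s' → Conv n n' →
      Conv (natInd C z s n) (natInd C' z' s' n')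
  | id {A A' a a' b b'} :
      Conv A A' → Conv a a' → Conv b b' → Conv (id A a b) (id A' a' b')
  | refl {a a'} : Conv a a' → Conv (refl a) (refl a')
  | idInd {C C' c c' p p'} :
      Conv C C' → Conv c c' → Conv p p' → Conv (idInd C c p) (idInd C' c' p')
  | gq {V V' E E'} : Conv V V' → Conv E E' → Conv (gq V E) (gq V' E')
  | gqPt {v v'} : Conv v v' → Conv (gqPt v) (gqPt v')
  | gqEdge {i i' j j' e e'} :
      Conv i i' → Conv j j' → Conv e e' → Conv (gqEdge i j e) (gqEdge i' j' e')
  | gqInd {P P' p p' q q' x x'} : Conv P P' → Conv p p' → Conv q q' → Conv x x' →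
      Conv (gqInd P p q x) (gqInd P' p' q' x')
  | gqComp {P P' p p' q q' i i' j j' e e'} : Conv P P' → Conv p p' → Conv q q' →
      Conv i i' → Conv j j' → Conv e e' → Conv (gqComp P p q i j e) (gqComp P' p' q' i' j' e')
  | funext {A A' B B' f f' g g'} : Conv A A' → Conv B B' → Conv f f' → Conv g g' →
      Conv (funext A B f g) (funext A' B' f' g')
  | ua {A A' B B'} : Conv A A' → Conv B B' → Conv (ua A B) (ua A' B')

/-! ### Typing -/

/-- The types that the edge case of an induction over the graph quotient must have, in the context
extended by `i j : V` and `e : E i j`: the type `tr P (edge e) (p i) = p j`. -/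
def gqEdgeCase (P p : Tm) : Tm :=
  id (P.subst (scons (gqPt (var 1)) (shift 3)))
    (tr (P.rename (up (fun n => n + 3))) (gqEdge (var 2) (var 1) (var 0))
      (p.subst (scons (var 2) (shift 3))))
    (p.subst (scons (var 1) (shift 3)))

/-- The judgements: well-formedness of a context (the most recent variable comes first; each entry
is a type in the context given by the rest of the list), and `Γ ⊢ t : A`. -/
inductive Judgement
  | ctx (Γ : List Tm)
  | typing (Γ : List Tm) (t A : Tm)

open Judgement in
/-- Derivability. -/
inductive Derivable : Judgement → Prop
  -- contexts and variables
  | nil : Derivable (ctx [])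
  | cons {Γ A} : Derivable (typing Γ A (sort .large)) → Derivable (ctx (A :: Γ))
  | var {Γ n A} : Derivable (ctx Γ) → Γ[n]? = some A → Derivable (typing Γ (var n) (A.wk (n + 1)))
  -- conversion
  | conv {Γ t A B} : Derivable (typing Γ t A) → Conv A B →
      Derivable (typing Γ B (sort .large)) → Derivable (typing Γ t B)
  -- the universe
  | univ {Γ} : Derivable (ctx Γ) → Derivable (typing Γ U (sort .large))
  | incl {Γ A} : Derivable (typing Γ A U) → Derivable (typing Γ A (sort .large))
  -- dependent function types
  | pi {Γ A B s} : Derivable (typing Γ A (sort s)) → Derivable (typing (A :: Γ) B (sort s)) →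
      Derivable (typing Γ (pi A B) (sort s))
  | lam {Γ A B t} : Derivable (typing (A :: Γ) B (sort .large)) →
      Derivable (typing (A :: Γ) t B) → Derivable (typing Γ (lam A t) (pi A B))
  | app {Γ A B f a} : Derivable (typing Γ f (pi A B)) → Derivable (typing Γ a A) →
      Derivable (typing Γ (app f a) (B.inst a))
  -- dependent pair types
  | sig {Γ A B s} : Derivable (typing Γ A (sort s)) → Derivable (typing (A :: Γ) B (sort s)) →
      Derivable (typing Γ (sig A B) (sort s))
  | pair {Γ A B a b} : Derivable (typing (A :: Γ) B (sort .large)) → Derivable (typing Γ a A) →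
      Derivable (typing Γ b (B.inst a)) → Derivable (typing Γ (pair a b) (sig A B))
  | sigInd {Γ A B C d p} : Derivable (typing (sig A B :: Γ) C (sort .large)) →
      Derivable (typing (B :: A :: Γ) d (C.subst (scons (pair (var 1) (var 0)) (shift 2)))) →
      Derivable (typing Γ p (sig A B)) → Derivable (typing Γ (sigInd C d p) (C.inst p))
  -- disjoint sums
  | sum {Γ A B s} : Derivable (typing Γ A (sort s)) → Derivable (typing Γ B (sort s)) →
      Derivable (typing Γ (sum A B) (sort s))
  | inl {Γ A B a} : Derivable (typing Γ A (sort .large)) → Derivable (typing Γ B (sort .large)) →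
      Derivable (typing Γ a A) → Derivable (typing Γ (inl a) (sum A B))
  | inr {Γ A B b} : Derivable (typing Γ A (sort .large)) → Derivable (typing Γ B (sort .large)) →
      Derivable (typing Γ b B) → Derivable (typing Γ (inr b) (sum A B))
  | sumInd {Γ A B C l r s} : Derivable (typing (sum A B :: Γ) C (sort .large)) →
      Derivable (typing (A :: Γ) l (C.subst (scons (inl (var 0)) (shift 1)))) →
      Derivable (typing (B :: Γ) r (C.subst (scons (inr (var 0)) (shift 1)))) →
      Derivable (typing Γ s (sum A B)) → Derivable (typing Γ (sumInd C l r s) (C.inst s))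
  -- the empty type
  | empty {Γ} : Derivable (ctx Γ) → Derivable (typing Γ empty U)
  | emptyInd {Γ C t} : Derivable (typing (empty :: Γ) C (sort .large)) →
      Derivable (typing Γ t empty) → Derivable (typing Γ (emptyInd C t) (C.inst t))
  -- the unit type
  | unit {Γ} : Derivable (ctx Γ) → Derivable (typing Γ unit U)
  | star {Γ} : Derivable (ctx Γ) → Derivable (typing Γ star unit)
  | unitInd {Γ C c t} : Derivable (typing (unit :: Γ) C (sort .large)) →
      Derivable (typing Γ c (C.inst star)) → Derivable (typing Γ t unit) →
      Derivable (typing Γ (unitInd C c t) (C.inst t))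
  -- natural numbers
  | nat {Γ} : Derivable (ctx Γ) → Derivable (typing Γ nat U)
  | zero {Γ} : Derivable (ctx Γ) → Derivable (typing Γ zero nat)
  | succ {Γ n} : Derivable (typing Γ n nat) → Derivable (typing Γ (succ n) nat)
  | natInd {Γ C z s n} : Derivable (typing (nat :: Γ) C (sort .large)) →
      Derivable (typing Γ z (C.inst zero)) →
      Derivable (typing (C :: nat :: Γ) s (C.subst (scons (succ (var 1)) (shift 2)))) →
      Derivable (typing Γ n nat) → Derivable (typing Γ (natInd C z s n) (C.inst n))
  -- identity types
  | id {Γ A a b s} : Derivable (typing Γ A (sort s)) → Derivable (typing Γ a A) →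
      Derivable (typing Γ b A) → Derivable (typing Γ (id A a b) (sort s))
  | refl {Γ A a} : Derivable (typing Γ A (sort .large)) → Derivable (typing Γ a A) →
      Derivable (typing Γ (refl a) (id A a a))
  | idInd {Γ A a b C c p} :
      Derivable (typing (id (A.wk 1) (a.wk 1) (var 0) :: A :: Γ) C (sort .large)) →
      Derivable (typing Γ c (C.inst₂ a (refl a))) → Derivable (typing Γ p (id A a b)) →
      Derivable (typing Γ (idInd C c p) (C.inst₂ b p))
  -- graph quotients of small graphs
  | gq {Γ V E} : Derivable (typing Γ V U) → Derivable (typing (V.wk 1 :: V :: Γ) E U) →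
      Derivable (typing Γ (gq V E) U)
  | gqPt {Γ V E v} : Derivable (typing Γ V U) → Derivable (typing (V.wk 1 :: V :: Γ) E U) →
      Derivable (typing Γ v V) → Derivable (typing Γ (gqPt v) (gq V E))
  | gqEdge {Γ V E i j e} : Derivable (typing Γ V U) →
      Derivable (typing (V.wk 1 :: V :: Γ) E U) → Derivable (typing Γ i V) →
      Derivable (typing Γ j V) → Derivable (typing Γ e (E.inst₂ i j)) →
      Derivable (typing Γ (gqEdge i j e) (id (gq V E) (gqPt i) (gqPt j)))
  | gqInd {Γ V E P p q x} : Derivable (typing (gq V E :: Γ) P (sort .large)) →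
      Derivable (typing (V :: Γ) p (P.subst (scons (gqPt (var 0)) (shift 1)))) →
      Derivable (typing (E :: V.wk 1 :: V :: Γ) q (gqEdgeCase P p)) →
      Derivable (typing Γ x (gq V E)) → Derivable (typing Γ (gqInd P p q x) (P.inst x))
  | gqComp {Γ V E P p q i j e} : Derivable (typing (gq V E :: Γ) P (sort .large)) →
      Derivable (typing (V :: Γ) p (P.subst (scons (gqPt (var 0)) (shift 1)))) →
      Derivable (typing (E :: V.wk 1 :: V :: Γ) q (gqEdgeCase P p)) →
      Derivable (typing Γ i V) → Derivable (typing Γ j V) →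
      Derivable (typing Γ e (E.inst₂ i j)) →
      Derivable (typing Γ (gqComp P p q i j e)
        (id ((gqEdgeCase P p).inst₃ i j e)
          (apd P
            (gqInd (P.rename (up (fun n => n + 1))) (p.rename (up (fun n => n + 1)))
              (q.rename (up (up (up (fun n => n + 1))))) (var 0))
            (gqPt i) (gqEdge i j e))
          (q.inst₃ i j e)))
  -- function extensionality (for types of any size) and univalence
  | funext {Γ A B f g} : Derivable (typing (A :: Γ) B (sort .large)) →
      Derivable (typing Γ f (pi A B)) → Derivable (typing Γ g (pi A B)) →
      Derivable (typing Γ (funext A B f g)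
        (isEquiv (id (pi A B) f g) (htpy A B f g) (happly A B f g)))
  | ua {Γ A B} : Derivable (typing Γ A U) → Derivable (typing Γ B U) →
      Derivable (typing Γ (ua A B) (isEquiv (id U A B) (equiv A B) (idToEquiv A B)))

/-- A closed type is inhabited if type theory has a closed term of that type. -/
def HasClosedTerm (T : Tm) : Prop := ∃ t : Tm, Derivable (.typing [] t T)

/-! ### Propositions, embeddings, pushouts and joins -/

/-- `A` is a mere proposition: `Π (x y : A), x = y`. -/
def isProp (A : Tm) : Tm := pi A (pi (A.wk 1) (id (A.wk 2) (var 1) (var 0)))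

/-- The fiber `Σ (a : A), f a = x` of `f : A → X`. -/
def fib (A X f x : Tm) : Tm := sig A (id (X.wk 1) (app (f.wk 1) (var 0)) (x.wk 1))

/-- `f : A → X` is an embedding: all its fibers are mere propositions. -/
def isEmb (A X f : Tm) : Tm := pi X (isProp (fib (A.wk 1) (X.wk 1) (f.wk 1) (var 0)))

/-- The pushout `A +_C B` of `f : C → A` and `g : C → B`: the quotient of the graph with vertices
`A + B` and edges `E i j := Σ (c : C), (inl (f c) = i) × (inr (g c) = j)`, that is, the homotopy
coequalizer of `inl ∘ f` and `inr ∘ g`. -/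
def pushout (C A B f g : Tm) : Tm :=
  gq (sum A B)
    (sig (C.wk 2)
      (prod (id ((sum A B).wk 3) (inl (app (f.wk 3) (var 0))) (var 2))
        (id ((sum A B).wk 3) (inr (app (g.wk 3) (var 0))) (var 1))))

/-- The left inclusion `A → A +_C B` into a pushout. -/
def pushoutInl (A : Tm) : Tm := lam A (gqPt (inl (var 0)))

/-- The pullback `A ×_X B := Σ (a : A) (b : B), f a = g b` of `f : A → X` and `g : B → X`. -/
def pullback (A B X f g : Tm) : Tm :=
  sig A (sig (B.wk 1) (id (X.wk 2) (app (f.wk 2) (var 1)) (app (g.wk 2) (var 0))))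

/-- The projection `π₁ : A ×_X B → A`, `(a, b, p) ↦ a`. -/
def pullbackFst (A B X f g : Tm) : Tm :=
  lam (pullback A B X f g) (sigInd (A.wk 2) (var 1) (var 0))

/-- The projection `π₂ : A ×_X B → B`, `(a, b, p) ↦ b`. -/
def pullbackSnd (A B X f g : Tm) : Tm :=
  lam (pullback A B X f g) (sigInd (B.wk 2) (sigInd (B.wk 4) (var 1) (var 0)) (var 0))

/-- The domain `A *_X B` of the join of the maps `f : A → X` and `g : B → X`: the pushout of
`A ← A ×_X B → B`. -/
def joinOver (A B X f g : Tm) : Tm :=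
  pushout (pullback A B X f g) A B (pullbackFst A B X f g) (pullbackSnd A B X f g)

/-- The join `A * B` of types: the pushout of `A ← A × B → B`. -/
def join (A B : Tm) : Tm :=
  pushout (prod A B) A B
    (lam (prod A B) (sigInd (A.wk 2) (var 1) (var 0)))
    (lam (prod A B) (sigInd (B.wk 2) (var 0) (var 0)))

/-- `f : A → X` is a canonical idempotent for the join of maps: `inl : A → A *_X A` is an
equivalence. -/
def isCanonicalIdempotentMap (A X f : Tm) : Tm :=
  isEquiv A (joinOver A A X f f) (pushoutInl A)

/-- `P` is a canonical idempotent for the join of types: `inl : P → P * P` is an equivalence. -/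
def isCanonicalIdempotentType (P : Tm) : Tm :=
  isEquiv P (join P P) (pushoutInl P)

end MLTT

/-! ### Composition laws for renaming and substitution. -/

namespace MLTT
namespace Tm

/-! Mathematical content. Suppose `f` is an embedding. A section of the fibers of `inl : A → A *_X
A` is built by graph-quotient induction: over `inl a` take `(a, refl)`, over `inr b` take `(b, glue
(b, b, refl))`. On an edge `(a, b, p)` one must compare the transport of `(a, refl)` along `glue (a,
b, p)` with the value over `inr b`. Since the fiber of `f` over `f b` is a proposition, `(b, refl) =
(a, p)` there, and path induction reduces to the diagonal edge, where transporting `(b, refl)` along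
`g` gives `(b, g)`. The second components of the section make `inl` right invertible, and its first
components form a retraction because the section computes to `(a, refl)` at `inl a`.

Conversely, let `inl` be an equivalence and let `(a, p)`, `(b, q)` lie in the fiber of `f` over `x`.
The join map `f * f` restricts to `f` along `inl` and sends `glue (a, b, p)` to `p`, so in its fiber
over `x` both `(inl a, p)` and `(inl b, q)` equal `(inr b, q)`. An equivalence is injective on
fibers, which univalence reduces to the case of the identity map; hence `(a, p) = (b, q)`.

For types the forward direction is the same with a path `a = b` in place of the path in the fiber.
For the converse a retraction `g` of `inl` suffices: `x = g (inl x) = g (inr y) = g (inl y) = y`.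

Formal content. Existence of a derivation is established by reflection. Explicit closed proof terms
are written down (`Term.JoinMap.proof`, `Term.JoinType.proof`), and a bidirectional type checker
`check` is evaluated on them in the kernel. Its soundness (`sound`) says that a successful run
yields a derivation. It rests on closure of `Derivable` under weakening and substitution
(`Derivable.stable`), on reading off the components of a well-formed type (`Derivable.components`),
and on a convertibility test by normalization (`Tm.conv_of_convb`). Only soundness of the test is
needed: no confluence, termination or injectivity of type formers enters. -/

theorem up_comp (ρ ρ' : ℕ → ℕ) : up ρ' ∘ up ρ = up (ρ' ∘ ρ) := by
  funext n; cases n <;> rfl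

theorem ups_var (ρ : ℕ → ℕ) : ups (fun n => var (ρ n)) = fun n => var (up ρ n) := by
  funext n; cases n <;> rfl

theorem ups_var_id : ups var = var := by
  funext n; cases n <;> rfl

theorem rename_eq_subst (t : Tm) (ρ : ℕ → ℕ) : t.rename ρ = t.subst (fun n => var (ρ n)) := by
  induction t generalizing ρ <;> simp [rename, subst, ups_var, *]

theorem rename_rename (t : Tm) (ρ ρ' : ℕ → ℕ) :
    (t.rename ρ).rename ρ' = t.rename (ρ' ∘ ρ) := by
  induction t generalizing ρ ρ' <;> simp [rename, up_comp, *]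

theorem ups_comp_up (σ : ℕ → Tm) (ρ : ℕ → ℕ) : ups σ ∘ up ρ = ups (σ ∘ ρ) := by
  funext n; cases n <;> rfl

theorem subst_rename (t : Tm) (ρ : ℕ → ℕ) (σ : ℕ → Tm) :
    (t.rename ρ).subst σ = t.subst (σ ∘ ρ) := by
  induction t generalizing ρ σ <;> simp [rename, subst, ups_comp_up, *]

theorem rename_ups (σ : ℕ → Tm) (ρ : ℕ → ℕ) :
    (fun n => (ups σ n).rename (up ρ)) = ups (fun n => (σ n).rename ρ) := by
  funext n
  cases n with
  | zero => rfl
  | succ n => simp only [ups, wk, rename_rename]; rfl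

theorem rename_subst (t : Tm) (σ : ℕ → Tm) (ρ : ℕ → ℕ) :
    (t.subst σ).rename ρ = t.subst (fun n => (σ n).rename ρ) := by
  induction t generalizing σ ρ <;> simp [rename, subst, rename_ups, *]

theorem subst_ups (σ τ : ℕ → Tm) :
    (fun n => (ups σ n).subst (ups τ)) = ups (fun n => (σ n).subst τ) := by
  funext n
  cases n with
  | zero => rfl
  | succ n => simp only [ups, wk, subst_rename, rename_subst]; rfl

/-- The last of four composition laws. Each law needs its compatibility with lifting under a binder,
which for substitutions follows from the mixed renaming–substitution laws; hence the order renaming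
first, substitution last. -/
theorem subst_subst (t : Tm) (σ τ : ℕ → Tm) :
    (t.subst σ).subst τ = t.subst (fun n => (σ n).subst τ) := by
  induction t generalizing σ τ <;> simp [subst, subst_ups, *]

@[simp] theorem subst_var (t : Tm) : t.subst var = t := by
  induction t <;> simp [subst, ups_var_id, *]

theorem wk_subst (t : Tm) (k : ℕ) (σ : ℕ → Tm) : (t.wk k).subst σ = t.subst (fun n => σ (n + k)) :=
  subst_rename ..

theorem subst_wk (t : Tm) (k : ℕ) (σ : ℕ → Tm) :
    (t.subst σ).wk k = t.subst (fun n => (σ n).wk k) :=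
  rename_subst ..

theorem wk_wk (t : Tm) (k l : ℕ) : (t.wk k).wk l = t.wk (k + l) := by
  simp only [wk, rename_rename]; congr 1; funext n; simp [add_assoc]

theorem wk_inst (t a : Tm) : (t.wk 1).inst a = t := by
  rw [inst, wk_subst]; exact subst_var t

end Tm

/-! ### Substitution commutes with instantiation and preserves conversion. -/

open Tm

theorem Tm.inst_subst (t a : Tm) (σ : ℕ → Tm) :
    (t.inst a).subst σ = (t.subst (ups σ)).inst (a.subst σ) := by
  simp only [inst, subst_subst]; congr 1; funext n
  cases n with
  | zero => rfl
  | succ n => simp [scons, ups, shift, subst, wk_subst]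

theorem Tm.inst₂_subst (t a b : Tm) (σ : ℕ → Tm) :
    (t.inst₂ a b).subst σ = (t.subst (ups (ups σ))).inst₂ (a.subst σ) (b.subst σ) := by
  simp only [inst₂, subst_subst]; congr 1; funext n
  rcases n with _ | _ | n
  · rfl
  · rfl
  · simp [scons, ups, shift, subst, wk_subst]

theorem Tm.inst₃_subst (t a b c : Tm) (σ : ℕ → Tm) :
    (t.inst₃ a b c).subst σ =
      (t.subst (ups (ups (ups σ)))).inst₃ (a.subst σ) (b.subst σ) (c.subst σ) := by
  simp only [inst₃, subst_subst]; congr 1; funext n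
  rcases n with _ | _ | _ | n
  · rfl
  · rfl
  · rfl
  · simp [scons, ups, shift, subst, wk_subst]

/-- The computation rules are stated with `inst` and `inst₂`, so the commutation laws turn each
substituted redex into a redex again; the other cases are congruences. -/
theorem Conv.subst {t u : Tm} (h : Conv t u) (σ : ℕ → Tm) : Conv (t.subst σ) (u.subst σ) := by
  induction h generalizing σ
  case rfl => exact .rfl _
  case symm ih => exact .symm (ih σ)
  case trans ih₁ ih₂ => exact .trans (ih₁ σ) (ih₂ σ)
  case beta => rw [inst_subst]; exact .beta ..
  case sigInd_pair => rw [inst₂_subst]; exact .sigInd_pair ..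
  case sumInd_inl => rw [inst_subst]; exact .sumInd_inl ..
  case sumInd_inr => rw [inst_subst]; exact .sumInd_inr ..
  case unitInd_star => exact .unitInd_star ..
  case natInd_zero => exact .natInd_zero ..
  case natInd_succ => rw [inst₂_subst]; exact .natInd_succ ..
  case idInd_refl => exact .idInd_refl ..
  case gqInd_pt => rw [inst_subst]; exact .gqInd_pt ..
  all_goals
    simp only [Tm.subst]
    first
      | apply Conv.pi | apply Conv.lam | apply Conv.app | apply Conv.sig | apply Conv.pair
      | apply Conv.sigInd | apply Conv.sum | apply Conv.inl | apply Conv.inr | apply Conv.sumInd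
      | apply Conv.emptyInd | apply Conv.unitInd | apply Conv.succ | apply Conv.natInd
      | apply Conv.id | apply Conv.refl | apply Conv.idInd | apply Conv.gq | apply Conv.gqPt
      | apply Conv.gqEdge | apply Conv.gqInd | apply Conv.gqComp | apply Conv.funext
      | apply Conv.ua
    all_goals apply_assumption

/-! ### Substitution in the derived notions -/

@[simp] theorem Tm.ups_zero (σ : ℕ → Tm) : ups σ 0 = var 0 := by rfl

@[simp] theorem Tm.ups_ups_one (σ : ℕ → Tm) : ups (ups σ) 1 = var 1 := by rfl

@[simp] theorem Tm.ups_ups_ups_two (σ : ℕ → Tm) : ups (ups (ups σ)) 2 = var 2 := by rfl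

/-- The hypothesis isolates the only property of a `k`-fold lifting `τ` of `σ` that matters here:
how it acts beyond the `k` bound variables. One lemma then serves one, two and three binders. -/
theorem Tm.wk_subst_comm (t : Tm) {k : ℕ} {σ τ : ℕ → Tm} (h : ∀ n, τ (n + k) = (σ n).wk k) :
    (t.wk k).subst τ = (t.subst σ).wk k := by
  rw [wk_subst, subst_wk]; congr 1; funext n; exact h n

@[simp] theorem Tm.wk_one_subst_ups (t : Tm) (σ : ℕ → Tm) :
    (t.wk 1).subst (ups σ) = (t.subst σ).wk 1 :=
  wk_subst_comm t fun _ => rfl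

theorem Tm.ups_ups_add (σ : ℕ → Tm) (n : ℕ) : ups (ups σ) (n + 2) = (σ n).wk 2 :=
  wk_wk ..

@[simp] theorem Tm.wk_two_subst_ups (t : Tm) (σ : ℕ → Tm) :
    (t.wk 2).subst (ups (ups σ)) = (t.subst σ).wk 2 :=
  wk_subst_comm t (ups_ups_add σ)

theorem Tm.ups_ups_ups_add (σ : ℕ → Tm) (n : ℕ) : ups (ups (ups σ)) (n + 3) = (σ n).wk 3 :=
  (congrArg (wk 1) (ups_ups_add σ n)).trans (wk_wk ..)

@[simp] theorem Tm.wk_three_subst_ups (t : Tm) (σ : ℕ → Tm) :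
    (t.wk 3).subst (ups (ups (ups σ))) = (t.subst σ).wk 3 :=
  wk_subst_comm t (ups_ups_ups_add σ)

theorem Tm.subst_scons_subst (t u : Tm) {k : ℕ} {σ τ : ℕ → Tm}
    (h : ∀ n, τ (n + k) = (σ n).wk k) :
    (t.subst (scons u (shift k))).subst τ =
      (t.subst (ups σ)).subst (scons (u.subst τ) (shift k)) := by
  rw [subst_subst, subst_subst]; congr 1; funext n
  cases n with
  | zero => rfl
  | succ n =>
    simp only [scons, ups, shift, subst, wk_subst, h]
    exact rename_eq_subst ..

theorem Tm.rename_up_subst (t : Tm) {k : ℕ} {σ τ : ℕ → Tm} (h : ∀ n, τ (n + k) = (σ n).wk k) :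
    (t.rename (up (fun n => n + k))).subst (ups τ) =
      (t.subst (ups σ)).rename (up (fun n => n + k)) := by
  rw [subst_rename, rename_subst]; congr 1; funext n
  cases n with
  | zero => rfl
  | succ n =>
    simp only [Function.comp, ups, up, h, wk, rename_rename]
    congr 1

theorem Tm.rename_up₃_subst (t : Tm) (σ : ℕ → Tm) :
    (t.rename (up (up (up (fun n => n + 1))))).subst (ups (ups (ups (ups σ)))) =
      (t.subst (ups (ups (ups σ)))).rename (up (up (up (fun n => n + 1)))) := by
  rw [subst_rename, rename_subst]; congr 1; funext n
  rcases n with _ | _ | _ | n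
  · rfl
  · rfl
  · rfl
  · simp only [Function.comp, ups, up, wk, rename_rename]
    congr 1

theorem tr_subst (P p u : Tm) (σ : ℕ → Tm) :
    (tr P p u).subst σ = tr (P.subst (ups σ)) (p.subst σ) (u.subst σ) := by
  simp [tr, Tm.subst]

theorem apd_subst (P F a p : Tm) (σ : ℕ → Tm) :
    (apd P F a p).subst σ =
      apd (P.subst (ups σ)) (F.subst (ups σ)) (a.subst σ) (p.subst σ) := by
  simp [apd, Tm.subst, tr_subst, inst_subst, rename_up_subst _ (ups_ups_add σ)]

theorem gqEdgeCase_subst (P p : Tm) (σ : ℕ → Tm) :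
    (gqEdgeCase P p).subst (ups (ups (ups σ))) =
      gqEdgeCase (P.subst (ups σ)) (p.subst (ups σ)) := by
  simp [gqEdgeCase, Tm.subst, tr_subst, rename_up_subst _ (ups_ups_ups_add σ),
    subst_scons_subst _ _ (ups_ups_ups_add σ)]

theorem arrow_subst (A B : Tm) (σ : ℕ → Tm) :
    (arrow A B).subst σ = arrow (A.subst σ) (B.subst σ) := by
  simp [arrow, Tm.subst]

theorem prod_subst (A B : Tm) (σ : ℕ → Tm) :
    (prod A B).subst σ = prod (A.subst σ) (B.subst σ) := by
  simp [prod, Tm.subst]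

theorem isEquiv_subst (A B f : Tm) (σ : ℕ → Tm) :
    (isEquiv A B f).subst σ = isEquiv (A.subst σ) (B.subst σ) (f.subst σ) := by
  simp [isEquiv, prod_subst, arrow_subst, Tm.subst]

theorem equiv_subst (A B : Tm) (σ : ℕ → Tm) :
    (equiv A B).subst σ = equiv (A.subst σ) (B.subst σ) := by
  simp [equiv, arrow_subst, Tm.subst, isEquiv_subst]

theorem idEquiv_subst (A : Tm) (σ : ℕ → Tm) : (idEquiv A).subst σ = idEquiv (A.subst σ) := by
  simp [idEquiv, idFun, Tm.subst]

theorem idToEquiv_subst (A B : Tm) (σ : ℕ → Tm) :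
    (idToEquiv A B).subst σ = idToEquiv (A.subst σ) (B.subst σ) := by
  simp [idToEquiv, U, Tm.subst, equiv_subst, idEquiv_subst]

theorem htpy_subst (A B f g : Tm) (σ : ℕ → Tm) :
    (htpy A B f g).subst σ =
      htpy (A.subst σ) (B.subst (ups σ)) (f.subst σ) (g.subst σ) := by
  simp [htpy, Tm.subst]

theorem happly_subst (A B f g : Tm) (σ : ℕ → Tm) :
    (happly A B f g).subst σ =
      happly (A.subst σ) (B.subst (ups σ)) (f.subst σ) (g.subst σ) := by
  simp [happly, Tm.subst, htpy_subst, rename_up_subst _ (ups_ups_ups_add σ)]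

end MLTT

namespace MLTT
open Tm Judgement

/-! ### Admissibility of weakening and substitution -/

/-- A class `K Γ Δ σ` of simultaneous substitutions `σ` from `Γ` to `Δ` that are well typed on
variables, closed under lifting along binders. -/
structure SubstClass (K : List Tm → List Tm → (ℕ → Tm) → Prop) : Prop where
  var {Γ Δ σ n A} : K Γ Δ σ → Derivable (ctx Δ) → Γ[n]? = some A →
    Derivable (typing Δ (σ n) ((A.wk (n + 1)).subst σ))
  ups {Γ Δ σ A} : K Γ Δ σ → Derivable (typing Δ (A.subst σ) (sort .large)) →
    K (A :: Γ) (A.subst σ :: Δ) (ups σ)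

/-- The types in `Γ` remain types under the substitutions in the class `K`. -/
def CtxStable (K : List Tm → List Tm → (ℕ → Tm) → Prop) : List Tm → Prop
  | [] => True
  | A :: Γ => CtxStable K Γ ∧ ∀ Δ σ, K Γ Δ σ → Derivable (ctx Δ) →
      Derivable (typing Δ (A.subst σ) (sort .large))

/-- The judgement remains derivable under the substitutions in the class `K`. -/
def Stable (K : List Tm → List Tm → (ℕ → Tm) → Prop) : Judgement → Prop
  | ctx Γ => CtxStable K Γ
  | typing Γ t A => CtxStable K Γ ∧ ∀ Δ σ, K Γ Δ σ → Derivable (ctx Δ) →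
      Derivable (typing Δ (t.subst σ) (A.subst σ))

section
variable {K : List Tm → List Tm → (ℕ → Tm) → Prop} {Γ Δ : List Tm} {σ : ℕ → Tm}
  {A B C t T : Tm}

theorem SubstClass.lift (S : SubstClass K) (h : CtxStable K (A :: Γ)) (hσ : K Γ Δ σ)
    (hΔ : Derivable (ctx Δ)) :
    K (A :: Γ) (A.subst σ :: Δ) (Tm.ups σ) ∧ Derivable (ctx (A.subst σ :: Δ)) :=
  ⟨S.ups hσ (h.2 _ _ hσ hΔ), .cons (h.2 _ _ hσ hΔ)⟩

theorem Stable.under (S : SubstClass K) (h : Stable K (typing (A :: Γ) t T)) (hσ : K Γ Δ σ)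
    (hΔ : Derivable (ctx Δ)) :
    Derivable (typing (A.subst σ :: Δ) (t.subst (ups σ)) (T.subst (ups σ))) :=
  have l := S.lift h.1 hσ hΔ
  h.2 _ _ l.1 l.2

theorem Stable.under₂ (S : SubstClass K) (h : Stable K (typing (B :: A :: Γ) t T)) (hσ : K Γ Δ σ)
    (hΔ : Derivable (ctx Δ)) :
    Derivable (typing (B.subst (ups σ) :: A.subst σ :: Δ)
      (t.subst (ups (ups σ))) (T.subst (ups (ups σ)))) :=
  have l := S.lift h.1.1 hσ hΔ
  h.under S l.1 l.2

theorem Stable.under₃ (S : SubstClass K) (h : Stable K (typing (C :: B :: A :: Γ) t T))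
    (hσ : K Γ Δ σ) (hΔ : Derivable (ctx Δ)) :
    Derivable (typing (C.subst (ups (ups σ)) :: B.subst (ups σ) :: A.subst σ :: Δ)
      (t.subst (ups (ups (ups σ)))) (T.subst (ups (ups (ups σ))))) :=
  have l := S.lift h.1.1.1 hσ hΔ
  h.under₂ S l.1 l.2

end

/-- One induction on derivations for weakening and substitution alike. Rules such as `lam` have no
premise that the domain is a type, so the induction hypothesis also carries stability of the context
entries, which is what permits lifting `σ` under the binder. -/
theorem Derivable.stable {K : List Tm → List Tm → (ℕ → Tm) → Prop} (S : SubstClass K)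
    {J : Judgement} (h : Derivable J) : Stable K J := by
  induction h
  case nil => trivial
  case cons ih => exact ih
  case var hn ih => exact ⟨ih, fun Δ σ hσ hΔ => S.var hσ hΔ hn⟩
  case conv hc _ ih₁ ih₂ =>
    exact ⟨ih₁.1, fun Δ σ hσ hΔ => .conv (ih₁.2 _ _ hσ hΔ) (hc.subst σ) (ih₂.2 _ _ hσ hΔ)⟩
  case univ ih => exact ⟨ih, fun Δ σ hσ hΔ => .univ hΔ⟩
  case incl ih => exact ⟨ih.1, fun Δ σ hσ hΔ => .incl (ih.2 _ _ hσ hΔ)⟩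
  case pi ih₁ ih₂ =>
    exact ⟨ih₁.1, fun Δ σ hσ hΔ => .pi (ih₁.2 _ _ hσ hΔ) (ih₂.under S hσ hΔ)⟩
  case lam ih₁ ih₂ =>
    exact ⟨ih₁.1.1, fun Δ σ hσ hΔ => .lam (ih₁.under S hσ hΔ) (ih₂.under S hσ hΔ)⟩
  case app ih₁ ih₂ =>
    refine ⟨ih₁.1, fun Δ σ hσ hΔ => ?_⟩
    rw [inst_subst]
    exact .app (ih₁.2 _ _ hσ hΔ) (ih₂.2 _ _ hσ hΔ)
  case sig ih₁ ih₂ =>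
    exact ⟨ih₁.1, fun Δ σ hσ hΔ => .sig (ih₁.2 _ _ hσ hΔ) (ih₂.under S hσ hΔ)⟩
  case pair ih₁ ih₂ ih₃ =>
    refine ⟨ih₂.1, fun Δ σ hσ hΔ => .pair (ih₁.under S hσ hΔ) (ih₂.2 _ _ hσ hΔ) ?_⟩
    rw [← inst_subst]
    exact ih₃.2 _ _ hσ hΔ
  case sigInd ih₁ ih₂ ih₃ =>
    refine ⟨ih₃.1, fun Δ σ hσ hΔ => ?_⟩
    rw [inst_subst]
    refine .sigInd (ih₁.under S hσ hΔ) ?_ (ih₃.2 _ _ hσ hΔ)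
    have := ih₂.under₂ S hσ hΔ
    rwa [subst_scons_subst _ _ (ups_ups_add σ)] at this
  case sum ih₁ ih₂ =>
    exact ⟨ih₁.1, fun Δ σ hσ hΔ => .sum (ih₁.2 _ _ hσ hΔ) (ih₂.2 _ _ hσ hΔ)⟩
  case inl ih₁ ih₂ ih₃ =>
    exact ⟨ih₁.1, fun Δ σ hσ hΔ =>
      .inl (ih₁.2 _ _ hσ hΔ) (ih₂.2 _ _ hσ hΔ) (ih₃.2 _ _ hσ hΔ)⟩
  case inr ih₁ ih₂ ih₃ =>
    exact ⟨ih₁.1, fun Δ σ hσ hΔ =>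
      .inr (ih₁.2 _ _ hσ hΔ) (ih₂.2 _ _ hσ hΔ) (ih₃.2 _ _ hσ hΔ)⟩
  case sumInd ih₁ ih₂ ih₃ ih₄ =>
    refine ⟨ih₄.1, fun Δ σ hσ hΔ => ?_⟩
    rw [inst_subst]
    refine .sumInd (ih₁.under S hσ hΔ) ?_ ?_ (ih₄.2 _ _ hσ hΔ)
    · have := ih₂.under S hσ hΔ
      rwa [subst_scons_subst _ _ fun n => Eq.refl (ups σ (n + 1))] at this
    · have := ih₃.under S hσ hΔ
      rwa [subst_scons_subst _ _ fun n => Eq.refl (ups σ (n + 1))] at this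
  case empty ih => exact ⟨ih, fun Δ σ hσ hΔ => .empty hΔ⟩
  case emptyInd ih₁ ih₂ =>
    refine ⟨ih₂.1, fun Δ σ hσ hΔ => ?_⟩
    rw [inst_subst]
    exact .emptyInd (ih₁.under S hσ hΔ) (ih₂.2 _ _ hσ hΔ)
  case unit ih => exact ⟨ih, fun Δ σ hσ hΔ => .unit hΔ⟩
  case star ih => exact ⟨ih, fun Δ σ hσ hΔ => .star hΔ⟩
  case unitInd ih₁ ih₂ ih₃ =>
    refine ⟨ih₂.1, fun Δ σ hσ hΔ => ?_⟩
    rw [inst_subst]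
    refine .unitInd (ih₁.under S hσ hΔ) ?_ (ih₃.2 _ _ hσ hΔ)
    have := ih₂.2 _ _ hσ hΔ
    rwa [inst_subst] at this
  case nat ih => exact ⟨ih, fun Δ σ hσ hΔ => .nat hΔ⟩
  case zero ih => exact ⟨ih, fun Δ σ hσ hΔ => .zero hΔ⟩
  case succ ih => exact ⟨ih.1, fun Δ σ hσ hΔ => .succ (ih.2 _ _ hσ hΔ)⟩
  case natInd ih₁ ih₂ ih₃ ih₄ =>
    refine ⟨ih₂.1, fun Δ σ hσ hΔ => ?_⟩
    rw [inst_subst]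
    refine .natInd (ih₁.under S hσ hΔ) ?_ ?_ (ih₄.2 _ _ hσ hΔ)
    · have := ih₂.2 _ _ hσ hΔ
      rwa [inst_subst] at this
    · have := ih₃.under₂ S hσ hΔ
      rwa [subst_scons_subst _ _ (ups_ups_add σ)] at this
  case id ih₁ ih₂ ih₃ =>
    exact ⟨ih₁.1, fun Δ σ hσ hΔ =>
      .id (ih₁.2 _ _ hσ hΔ) (ih₂.2 _ _ hσ hΔ) (ih₃.2 _ _ hσ hΔ)⟩
  case refl ih₁ ih₂ =>
    exact ⟨ih₁.1, fun Δ σ hσ hΔ => .refl (ih₁.2 _ _ hσ hΔ) (ih₂.2 _ _ hσ hΔ)⟩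
  case idInd ih₁ ih₂ ih₃ =>
    refine ⟨ih₂.1, fun Δ σ hσ hΔ => ?_⟩
    rw [inst₂_subst]
    refine .idInd ?_ ?_ (ih₃.2 _ _ hσ hΔ)
    · have := ih₁.under₂ S hσ hΔ
      simpa only [Tm.subst, wk_one_subst_ups, ups_zero] using this
    · have := ih₂.2 _ _ hσ hΔ
      rwa [inst₂_subst] at this
  case gq ih₁ ih₂ =>
    refine ⟨ih₁.1, fun Δ σ hσ hΔ => .gq (ih₁.2 _ _ hσ hΔ) ?_⟩
    have := ih₂.under₂ S hσ hΔ
    rwa [wk_one_subst_ups] at this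
  case gqPt ih₁ ih₂ ih₃ =>
    refine ⟨ih₁.1, fun Δ σ hσ hΔ => .gqPt (ih₁.2 _ _ hσ hΔ) ?_ (ih₃.2 _ _ hσ hΔ)⟩
    have := ih₂.under₂ S hσ hΔ
    rwa [wk_one_subst_ups] at this
  case gqEdge ih₁ ih₂ ih₃ ih₄ ih₅ =>
    refine ⟨ih₁.1, fun Δ σ hσ hΔ =>
      .gqEdge (ih₁.2 _ _ hσ hΔ) ?_ (ih₃.2 _ _ hσ hΔ) (ih₄.2 _ _ hσ hΔ) ?_⟩
    · have := ih₂.under₂ S hσ hΔ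
      rwa [wk_one_subst_ups] at this
    · have := ih₅.2 _ _ hσ hΔ
      rwa [inst₂_subst] at this
  case gqInd ih₁ ih₂ ih₃ ih₄ =>
    refine ⟨ih₄.1, fun Δ σ hσ hΔ => ?_⟩
    rw [inst_subst]
    refine .gqInd (ih₁.under S hσ hΔ) ?_ ?_ (ih₄.2 _ _ hσ hΔ)
    · have := ih₂.under S hσ hΔ
      rwa [subst_scons_subst _ _ fun n => Eq.refl (ups σ (n + 1))] at this
    · have := ih₃.under₃ S hσ hΔ
      rwa [wk_one_subst_ups, gqEdgeCase_subst] at this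
  case gqComp ih₁ ih₂ ih₃ ih₄ ih₅ ih₆ =>
    refine ⟨ih₄.1, fun Δ σ hσ hΔ => ?_⟩
    have h₂ := ih₂.under S hσ hΔ
    have h₃ := ih₃.under₃ S hσ hΔ
    have h₆ := ih₆.2 _ _ hσ hΔ
    rw [subst_scons_subst _ _ fun n => Eq.refl (ups σ (n + 1))] at h₂
    rw [wk_one_subst_ups, gqEdgeCase_subst] at h₃
    rw [inst₂_subst] at h₆
    have := Derivable.gqComp (ih₁.under S hσ hΔ) h₂ h₃ (ih₄.2 _ _ hσ hΔ) (ih₅.2 _ _ hσ hΔ) h₆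
    -- The type in this rule contains copies of `P`, `p`, `q` weakened below their own binders; the
    -- `rename_up` lemmas move the substitution past them.
    simpa only [Tm.subst, inst₃_subst, gqEdgeCase_subst, apd_subst, rename_up₃_subst,
      rename_up_subst _ fun n => Eq.refl (ups σ (n + 1)), ups_zero] using this
  case funext ih₁ ih₂ ih₃ =>
    refine ⟨ih₂.1, fun Δ σ hσ hΔ => ?_⟩
    rw [isEquiv_subst, htpy_subst, happly_subst]
    exact .funext (ih₁.under S hσ hΔ) (ih₂.2 _ _ hσ hΔ) (ih₃.2 _ _ hσ hΔ)
  case ua ih₁ ih₂ =>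
    refine ⟨ih₁.1, fun Δ σ hσ hΔ => ?_⟩
    rw [isEquiv_subst, equiv_subst, idToEquiv_subst]
    exact .ua (ih₁.2 _ _ hσ hΔ) (ih₂.2 _ _ hσ hΔ)

/-- The renaming `ρ` sends the variables of `Γ` to variables of the same type in `Δ`. -/
def IsRenaming (Γ Δ : List Tm) (σ : ℕ → Tm) : Prop :=
  ∃ ρ : ℕ → ℕ, σ = (fun n => var (ρ n)) ∧ ∀ n A, Γ[n]? = some A →
    ∃ A', Δ[ρ n]? = some A' ∧ A'.wk (ρ n + 1) = (A.wk (n + 1)).rename ρ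

theorem isRenaming_substClass : SubstClass IsRenaming where
  var := by
    rintro Γ Δ _ n A ⟨ρ, rfl, h⟩ hΔ hn
    obtain ⟨A', hA', e⟩ := h n A hn
    rw [← rename_eq_subst, ← e]
    exact .var hΔ hA'
  ups := by
    rintro Γ Δ _ A ⟨ρ, rfl, h⟩ -
    refine ⟨up ρ, ups_var ρ, ?_⟩
    rintro (_ | n) B hB
    · obtain rfl : A = B := by simpa using hB
      refine ⟨_, rfl, ?_⟩
      rw [← rename_eq_subst]
      simp only [wk, up, rename_rename]
      congr 1
    · obtain ⟨A', hA', e⟩ := h n B (by simpa using hB)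
      refine ⟨A', by simpa [up] using hA', ?_⟩
      have e₁ : A'.wk (up ρ (n + 1) + 1) = (A'.wk (ρ n + 1)).wk 1 := (wk_wk ..).symm
      have e₂ : B.wk (n + 1 + 1) = (B.wk (n + 1)).wk 1 := (wk_wk ..).symm
      rw [e₁, e₂, e]
      simp only [wk, rename_rename]
      congr 1

variable {Γ : List Tm} {A B a b t T : Tm}

theorem Derivable.ctx_tail (h : Derivable (ctx (A :: Γ))) :
    Derivable (typing Γ A (sort .large)) := by
  cases h; assumption

theorem Derivable.wk_append (Δ : List Tm) (h : Derivable (typing Γ t T))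
    (hΔ : Derivable (ctx (Δ ++ Γ))) :
    Derivable (typing (Δ ++ Γ) (t.wk Δ.length) (T.wk Δ.length)) := by
  simp only [wk, rename_eq_subst]
  refine (h.stable isRenaming_substClass).2 _ _ ⟨_, rfl, fun n A hn => ⟨A, ?_, ?_⟩⟩ hΔ
  · rw [List.getElem?_append_right (by omega)]; simpa using hn
  · simp only [wk, rename_rename]
    congr 1; funext m; simp; omega

theorem Derivable.wk_one (h : Derivable (typing Γ t T))
    (hB : Derivable (typing Γ B (sort .large))) :
    Derivable (typing (B :: Γ) (t.wk 1) (T.wk 1)) :=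
  h.wk_append [B] (.cons hB)

/-- The substitution `σ` is well typed on the variables of `Γ`. -/
def IsSubst (Γ Δ : List Tm) (σ : ℕ → Tm) : Prop :=
  ∀ n A, Γ[n]? = some A → Derivable (typing Δ (σ n) ((A.wk (n + 1)).subst σ))

/-- Lifting a substitution weakens its values, so this uses weakening, the already established
instance of `Derivable.stable` for renamings. -/
theorem isSubst_substClass : SubstClass IsSubst where
  var h _ hn := h _ _ hn
  ups := by
    intro Γ Δ σ A h hA
    rintro (_ | n) B hB
    · obtain rfl : A = B := by simpa using hB
      rw [wk_one_subst_ups]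
      exact .var (.cons hA) rfl
    · have e : B.wk (n + 1 + 1) = (B.wk (n + 1)).wk 1 := (wk_wk ..).symm
      rw [e, wk_one_subst_ups]
      exact (h n B (by simpa using hB)).wk_one hA

theorem Derivable.subst {Δ : List Tm} {σ : ℕ → Tm} (h : Derivable (typing Γ t T))
    (hσ : IsSubst Γ Δ σ) (hΔ : Derivable (ctx Δ)) :
    Derivable (typing Δ (t.subst σ) (T.subst σ)) :=
  (h.stable isSubst_substClass).2 _ _ hσ hΔ

theorem isSubst_var (hΓ : Derivable (ctx Γ)) : IsSubst Γ Γ (shift 0) := fun n A hn => by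
  have e : shift 0 = Tm.var := rfl
  rw [e, subst_var]
  exact .var hΓ hn

theorem IsSubst.scons {Δ : List Tm} {σ : ℕ → Tm} (h : IsSubst Γ Δ σ)
    (ha : Derivable (typing Δ a (A.subst σ))) : IsSubst (A :: Γ) Δ (scons a σ) := by
  rintro (_ | n) B hB
  · obtain rfl : A = B := by simpa using hB
    rw [wk_subst]; exact ha
  · have e : B.wk (n + 1 + 1) = (B.wk (n + 1)).wk 1 := (wk_wk ..).symm
    rw [e, wk_subst]
    exact h n B (by simpa using hB)

theorem subst_shift_zero (t : Tm) : t.subst (shift 0) = t := subst_var t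

theorem Derivable.inst (h : Derivable (typing (A :: Γ) t T)) (hΓ : Derivable (ctx Γ))
    (ha : Derivable (typing Γ a A)) : Derivable (typing Γ (t.inst a) (T.inst a)) :=
  h.subst ((isSubst_var hΓ).scons (by rwa [subst_shift_zero])) hΓ

theorem Derivable.inst₂ (h : Derivable (typing (B :: A :: Γ) t T)) (hΓ : Derivable (ctx Γ))
    (ha : Derivable (typing Γ a A)) (hb : Derivable (typing Γ b (B.inst a))) :
    Derivable (typing Γ (t.inst₂ a b) (T.inst₂ a b)) :=
  h.subst (((isSubst_var hΓ).scons (by rwa [subst_shift_zero])).scons hb) hΓ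

end MLTT

namespace MLTT
open Tm

/-! ### Substitution by recursors

These versions of renaming and substitution are defined directly by the recursor, so that the
kernel evaluates them quickly. -/

noncomputable def Tm.renameRec (t : Tm) : (ℕ → ℕ) → Tm :=
  Tm.rec (motive := fun _ => (ℕ → ℕ) → Tm)
    (fun n σ => .var (σ n))
    (fun s _ => .sort s)
    (fun _ _ A B σ => .pi (A σ) (B (up σ)))
    (fun _ _ A t σ => .lam (A σ) (t (up σ)))
    (fun _ _ f a σ => .app (f σ) (a σ))
    (fun _ _ A B σ => .sig (A σ) (B (up σ)))
    (fun _ _ a b σ => .pair (a σ) (b σ))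
    (fun _ _ _ C d p σ => .sigInd (C (up σ)) (d (up (up σ))) (p σ))
    (fun _ _ A B σ => .sum (A σ) (B σ))
    (fun _ a σ => .inl (a σ))
    (fun _ b σ => .inr (b σ))
    (fun _ _ _ _ C l r s σ => .sumInd (C (up σ)) (l (up σ)) (r (up σ)) (s σ))
    (fun _ => .empty)
    (fun _ _ C t σ => .emptyInd (C (up σ)) (t σ))
    (fun _ => .unit)
    (fun _ => .star)
    (fun _ _ _ C c t σ => .unitInd (C (up σ)) (c σ) (t σ))
    (fun _ => .nat)
    (fun _ => .zero)
    (fun _ n σ => .succ (n σ))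
    (fun _ _ _ _ C z s n σ => .natInd (C (up σ)) (z σ) (s (up (up σ))) (n σ))
    (fun _ _ _ A a b σ => .id (A σ) (a σ) (b σ))
    (fun _ a σ => .refl (a σ))
    (fun _ _ _ C c p σ => .idInd (C (up (up σ))) (c σ) (p σ))
    (fun _ _ V E σ => .gq (V σ) (E (up (up σ))))
    (fun _ v σ => .gqPt (v σ))
    (fun _ _ _ i j e σ => .gqEdge (i σ) (j σ) (e σ))
    (fun _ _ _ _ P p q x σ => .gqInd (P (up σ)) (p (up σ)) (q (up (up (up σ)))) (x σ))
    (fun _ _ _ _ _ _ P p q i j e σ => .gqComp (P (up σ)) (p (up σ)) (q (up (up (up σ)))) (i σ) (j σ) (e σ))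
    (fun _ _ _ _ A B f g σ => .funext (A σ) (B (up σ)) (f σ) (g σ))
    (fun _ _ A B σ => .ua (A σ) (B σ))
    t

theorem Tm.renameRec_eq (t : Tm) (ρ : ℕ → ℕ) : t.renameRec ρ = t.rename ρ := by
  induction t generalizing ρ <;> simp_all [renameRec, rename]

noncomputable def Tm.upsRec (σ : ℕ → Tm) : ℕ → Tm := fun n =>
  Nat.rec (.var 0) (fun n _ => (σ n).renameRec (fun n => n + 1)) n

theorem Tm.upsRec_eq (σ : ℕ → Tm) : upsRec σ = ups σ := by
  funext n; cases n
  · rfl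
  · exact renameRec_eq ..

noncomputable def Tm.substRec (t : Tm) : (ℕ → Tm) → Tm :=
  Tm.rec (motive := fun _ => (ℕ → Tm) → Tm)
    (fun n σ => σ n)
    (fun s _ => .sort s)
    (fun _ _ A B σ => .pi (A σ) (B (upsRec σ)))
    (fun _ _ A t σ => .lam (A σ) (t (upsRec σ)))
    (fun _ _ f a σ => .app (f σ) (a σ))
    (fun _ _ A B σ => .sig (A σ) (B (upsRec σ)))
    (fun _ _ a b σ => .pair (a σ) (b σ))
    (fun _ _ _ C d p σ => .sigInd (C (upsRec σ)) (d (upsRec (upsRec σ))) (p σ))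
    (fun _ _ A B σ => .sum (A σ) (B σ))
    (fun _ a σ => .inl (a σ))
    (fun _ b σ => .inr (b σ))
    (fun _ _ _ _ C l r s σ => .sumInd (C (upsRec σ)) (l (upsRec σ)) (r (upsRec σ)) (s σ))
    (fun _ => .empty)
    (fun _ _ C t σ => .emptyInd (C (upsRec σ)) (t σ))
    (fun _ => .unit)
    (fun _ => .star)
    (fun _ _ _ C c t σ => .unitInd (C (upsRec σ)) (c σ) (t σ))
    (fun _ => .nat)
    (fun _ => .zero)
    (fun _ n σ => .succ (n σ))
    (fun _ _ _ _ C z s n σ => .natInd (C (upsRec σ)) (z σ) (s (upsRec (upsRec σ))) (n σ))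
    (fun _ _ _ A a b σ => .id (A σ) (a σ) (b σ))
    (fun _ a σ => .refl (a σ))
    (fun _ _ _ C c p σ => .idInd (C (upsRec (upsRec σ))) (c σ) (p σ))
    (fun _ _ V E σ => .gq (V σ) (E (upsRec (upsRec σ))))
    (fun _ v σ => .gqPt (v σ))
    (fun _ _ _ i j e σ => .gqEdge (i σ) (j σ) (e σ))
    (fun _ _ _ _ P p q x σ => .gqInd (P (upsRec σ)) (p (upsRec σ)) (q (upsRec (upsRec (upsRec σ)))) (x σ))
    (fun _ _ _ _ _ _ P p q i j e σ => .gqComp (P (upsRec σ)) (p (upsRec σ)) (q (upsRec (upsRec (upsRec σ)))) (i σ) (j σ) (e σ))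
    (fun _ _ _ _ A B f g σ => .funext (A σ) (B (upsRec σ)) (f σ) (g σ))
    (fun _ _ A B σ => .ua (A σ) (B σ))
    t

theorem Tm.substRec_eq (t : Tm) (σ : ℕ → Tm) : t.substRec σ = t.subst σ := by
  induction t generalizing σ <;> simp_all [substRec, subst, upsRec_eq]

noncomputable def Tm.wkRec (k : ℕ) (t : Tm) : Tm := t.renameRec fun n => n + k

noncomputable def Tm.sconsRec (a : Tm) (σ : ℕ → Tm) : ℕ → Tm := fun n =>
  Nat.rec a (fun n _ => σ n) n

noncomputable def Tm.instRec (t a : Tm) : Tm := t.substRec (sconsRec a var)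

noncomputable def Tm.inst₂Rec (t a b : Tm) : Tm := t.substRec (sconsRec b (sconsRec a var))

theorem Tm.sconsRec_eq (a : Tm) (σ : ℕ → Tm) : sconsRec a σ = scons a σ := by
  funext n; cases n <;> rfl

theorem Tm.wkRec_eq (k : ℕ) (t : Tm) : wkRec k t = wk k t := renameRec_eq ..

theorem Tm.instRec_eq (t a : Tm) : t.instRec a = t.inst a := by
  rw [instRec, substRec_eq, sconsRec_eq]; rfl

theorem Tm.inst₂Rec_eq (t a b : Tm) : t.inst₂Rec a b = t.inst₂ a b := by
  rw [inst₂Rec, substRec_eq, sconsRec_eq, sconsRec_eq]; rfl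

end MLTT

namespace MLTT
open Tm Judgement

/-! ### Inversion -/

section
variable {Γ : List Tm} {A B V E a b t p u T P : Tm}

/-- What the derivability of a type says about its components. -/
def Judgement.Components : Judgement → Prop
  | typing Γ (.pi A B) _ | typing Γ (.sig A B) _ =>
    Derivable (typing Γ A (sort .large)) ∧ Derivable (typing (A :: Γ) B (sort .large))
  | typing Γ (.sum A B) _ =>
    Derivable (typing Γ A (sort .large)) ∧ Derivable (typing Γ B (sort .large))
  | typing Γ (.id A a b) _ => Derivable (typing Γ A (sort .large)) ∧
    Derivable (typing Γ a A) ∧ Derivable (typing Γ b A)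
  | typing Γ (.gq V E) _ => Derivable (typing Γ V U) ∧ Derivable (typing (V.wk 1 :: V :: Γ) E U)
  | _ => True

theorem Derivable.large {s : Size} (h : Derivable (typing Γ A (sort s))) :
    Derivable (typing Γ A (sort .large)) := by
  cases s
  · exact .incl h
  · exact h

/-- Conversion and inclusion of the universe change only the type of a term, never the term itself.
Components are therefore read off the syntactic shape of the subject, without injectivity of `pi` or
`sig` up to conversion. -/
theorem Derivable.components {J : Judgement} (h : Derivable J) : J.Components := by
  induction h with
  | @conv _ t _ _ _ _ _ ih _ => cases t <;> exact ih
  | @incl _ t _ ih => cases t <;> exact ih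
  | pi h₁ h₂ | sig h₁ h₂ | sum h₁ h₂ => exact ⟨h₁.large, h₂.large⟩
  | id h₁ h₂ h₃ => exact ⟨h₁.large, h₂, h₃⟩
  | gq h₁ h₂ => exact ⟨h₁, h₂⟩
  | _ => trivial

/-! ### Well-formedness of the types in the rules -/

theorem isSubst_shift (Δ : List Tm) (hΔ : Derivable (ctx (Δ ++ Γ))) :
    IsSubst Γ (Δ ++ Γ) (shift Δ.length) := fun n A hn => by
  have e : (A.wk (n + 1)).subst (shift Δ.length) = A.wk (n + Δ.length + 1) := by
    rw [wk_subst, wk, rename_eq_subst]; congr 1; funext m; simp [shift]; omega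
  rw [e]
  exact .var hΔ (by rw [List.getElem?_append_right (by omega)]; simpa using hn)

theorem Derivable.idCtx (hA : Derivable (typing Γ A (sort .large)))
    (ha : Derivable (typing Γ a A)) :
    Derivable (ctx (.id (A.wk 1) (a.wk 1) (.var 0) :: A :: Γ)) :=
  .cons (.id (hA.wk_one hA) (ha.wk_one hA) (.var (.cons hA) rfl))

theorem Derivable.inst₂_id {C : Tm} (hΓ : Derivable (ctx Γ))
    (hC : Derivable (typing (.id (A.wk 1) (a.wk 1) (.var 0) :: A :: Γ) C (sort .large)))
    (hb : Derivable (typing Γ b A)) (hp : Derivable (typing Γ p (.id A a b))) :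
    Derivable (typing Γ (C.inst₂ b p) (sort .large)) := by
  refine hC.inst₂ hΓ hb ?_
  have e : (Tm.id (A.wk 1) (a.wk 1) (.var 0)).inst b = .id A a b :=
    congrArg₂ (fun x y => Tm.id x y b) (wk_inst A b) (wk_inst a b)
  rwa [e]

theorem Derivable.transport (hA : Derivable (typing Γ A (sort .large)))
    (hP : Derivable (typing (A :: Γ) P (sort .large))) (ha : Derivable (typing Γ a A))
    (hp : Derivable (typing Γ p (.id A a b))) (hu : Derivable (typing Γ u (P.inst a))) :
    Derivable (typing Γ (tr P p u) (P.inst b)) := by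
  have e : ∀ x y, (P.wk 1).inst₂ x y = P.inst x := fun x y => by
    rw [Tm.inst₂, wk_subst, Tm.inst]; rfl
  rw [← e b p]
  refine .idInd (hP.wk_append [_] (hA.idCtx ha)) ?_ hp
  rwa [e]

/-- The checker may only check a term against an expression already known to be a type; this
supplies that fact for the edge case. Variables `2`, `1`, `0` are the two vertices and the edge. -/
theorem Derivable.gqEdgeCase {p : Tm} (hV : Derivable (typing Γ V U)) (hE : Derivable (typing (V.wk 1 :: V :: Γ) E U))
    (hP : Derivable (typing (.gq V E :: Γ) P (sort .large)))
    (hp : Derivable (typing (V :: Γ) p (P.subst (scons (.gqPt (.var 0)) (shift 1))))) :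
    Derivable (typing (E :: V.wk 1 :: V :: Γ) (gqEdgeCase P p) (sort .large)) := by
  have hΔ : Derivable (ctx (E :: V.wk 1 :: V :: Γ)) := .cons (.incl hE)
  have hs : IsSubst Γ (E :: V.wk 1 :: V :: Γ) (shift 3) := isSubst_shift [E, V.wk 1, V] hΔ
  have wkV : V.wk 3 = V.subst (shift 3) := rename_eq_subst ..
  have hV₃ := hV.subst hs hΔ
  have hE₃ := (hE.stable isSubst_substClass).under₂ isSubst_substClass hs hΔ
  have hG := (Derivable.gq hV hE).subst hs hΔ
  have h₂ : Derivable (typing (E :: V.wk 1 :: V :: Γ) (.var 2) (V.subst (shift 3))) := by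
    rw [← wkV]; exact .var hΔ rfl
  have h₁ : Derivable (typing (E :: V.wk 1 :: V :: Γ) (.var 1) (V.subst (shift 3))) := by
    rw [← wkV, ← wk_wk V 1 2]; exact .var hΔ rfl
  have h₀ : Derivable (typing (E :: V.wk 1 :: V :: Γ) (.var 0)
      ((E.subst (ups (ups (shift 3)))).inst₂ (.var 2) (.var 1))) := by
    have e : (E.subst (ups (ups (shift 3)))).inst₂ (.var 2) (.var 1) = E.wk (0 + 1) := by
      rw [Tm.inst₂, subst_subst, wk, rename_eq_subst]; congr 1; funext n
      rcases n with _ | _ | n <;> rfl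
    rw [e]; exact .var hΔ rfl
  rw [wk_one_subst_ups] at hE₃
  have hpt₁ := Derivable.gqPt hV₃ hE₃ h₁
  have hpt₂ := Derivable.gqPt hV₃ hE₃ h₂
  have hed := Derivable.gqEdge hV₃ hE₃ h₂ h₁ h₀
  have pe : ∀ x, (P.subst (scons (.gqPt (.var 0)) (shift 1))).subst (scons x (shift 3)) =
      P.subst (scons (.gqPt x) (shift 3)) := fun x => by
    rw [subst_subst]; congr 1; funext n; cases n <;> rfl
  have hp₁ := hp.subst (hs.scons h₁) hΔ
  have hp₂ := hp.subst (hs.scons h₂) hΔ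
  rw [pe] at hp₁ hp₂
  have hP₃ := (hP.stable isSubst_substClass).under isSubst_substClass hs hΔ
  have re : P.rename (up (fun n => n + 3)) = P.subst (ups (shift 3)) := by
    rw [rename_eq_subst]; congr 1; funext n; cases n <;> rfl
  have ie : ∀ x, (P.subst (ups (shift 3))).inst x = P.subst (scons x (shift 3)) := fun x => by
    rw [Tm.inst, subst_subst]; congr 1; funext n; cases n <;> rfl
  refine .id (hP.subst (hs.scons hpt₁) hΔ) ?_ hp₁
  rw [re, ← ie]
  exact .transport (.incl hG) hP₃ hpt₂ hed (by rwa [ie])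

end

/-! ### A type checker -/

/-- Syntactic equality, on the fragment of type theory that the type checker covers. -/
noncomputable def Tm.eqb (t : Tm) : Tm → Bool :=
  Tm.rec (motive := fun _ => Tm → Bool)
    (fun m u => match u with | .var n => m.beq n | _ => false)
    (fun s u => match s, u with
      | .small, .sort .small => true | .large, .sort .large => true | _, _ => false)
    (fun _ _ A B u => match u with | .pi A' B' => A A' && B B' | _ => false)
    (fun _ _ A t u => match u with | .lam A' t' => A A' && t t' | _ => false)
    (fun _ _ f a u => match u with | .app f' a' => f f' && a a' | _ => false)
    (fun _ _ A B u => match u with | .sig A' B' => A A' && B B' | _ => false)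
    (fun _ _ a b u => match u with | .pair a' b' => a a' && b b' | _ => false)
    (fun _ _ _ C d p u => match u with | .sigInd C' d' p' => C C' && d d' && p p' | _ => false)
    (fun _ _ A B u => match u with | .sum A' B' => A A' && B B' | _ => false)
    (fun _ a u => match u with | .inl a' => a a' | _ => false)
    (fun _ b u => match u with | .inr b' => b b' | _ => false)
    (fun _ _ _ _ C l r s u => match u with
      | .sumInd C' l' r' s' => C C' && l l' && r r' && s s'
      | _ => false)
    (fun _ => false)
    (fun _ _ _ _ _ => false)
    (fun _ => false)
    (fun _ => false)
    (fun _ _ _ _ _ _ _ => false)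
    (fun _ => false)
    (fun _ => false)
    (fun _ _ _ => false)
    (fun _ _ _ _ _ _ _ _ _ => false)
    (fun _ _ _ A a b u => match u with | .id A' a' b' => A A' && a a' && b b' | _ => false)
    (fun _ a u => match u with | .refl a' => a a' | _ => false)
    (fun _ _ _ C c p u => match u with | .idInd C' c' p' => C C' && c c' && p p' | _ => false)
    (fun _ _ V E u => match u with | .gq V' E' => V V' && E E' | _ => false)
    (fun _ v u => match u with | .gqPt v' => v v' | _ => false)
    (fun _ _ _ i j e u => match u with | .gqEdge i' j' e' => i i' && j j' && e e' | _ => false)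
    (fun _ _ _ _ P p q x u => match u with
      | .gqInd P' p' q' x' => P P' && p p' && q q' && x x'
      | _ => false)
    (fun _ _ _ _ _ _ _ _ _ _ _ _ _ => false)
    (fun _ _ _ _ _ _ _ _ _ => false)
    (fun _ _ _ _ _ => false)
    t

theorem Tm.eq_of_eqb (t u : Tm) (h : t.eqb u = true) : t = u := by
  induction t generalizing u with
  | var n =>
    cases u <;> first | cases h | exact congrArg _ (Nat.eq_of_beq_eq_true h)
  | sort s =>
    cases s <;> cases u <;> first | cases h | (rename_i s; cases s <;> first | rfl | cases h)
  | inl _ i | inr _ i | refl _ i | gqPt _ i =>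
    cases u <;> first | cases h | rw [i _ h]
  | pi _ _ i j | lam _ _ i j | app _ _ i j | sig _ _ i j | pair _ _ i j | sum _ _ i j
  | gq _ _ i j =>
    cases u <;> first | cases h | skip
    have h := Bool.and_eq_true_iff.1 h
    rw [i _ h.1, j _ h.2]
  | sigInd _ _ _ i j k | id _ _ _ i j k | idInd _ _ _ i j k | gqEdge _ _ _ i j k =>
    cases u <;> first | cases h | skip
    have h := Bool.and_eq_true_iff.1 h
    have h' := Bool.and_eq_true_iff.1 h.1
    rw [i _ h'.1, j _ h'.2, k _ h.2]
  | sumInd _ _ _ _ i j k l | gqInd _ _ _ _ i j k l =>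
    cases u <;> first | cases h | skip
    have h := Bool.and_eq_true_iff.1 h
    have h' := Bool.and_eq_true_iff.1 h.1
    have h'' := Bool.and_eq_true_iff.1 h'.1
    rw [i _ h''.1, j _ h''.2, k _ h'.2, l _ h.2]
  | _ => cases h

/-! Normalization of `app f a`, `sigInd C d p`, … when the head `f`, `p`, … has been normalized;
`r` normalizes the other components. -/

noncomputable def nfApp (r : Tm → Tm) (a : Tm) : Tm → Tm
  | .lam _ t => r (t.instRec a)
  | f => .app f (r a)

noncomputable def nfSigInd (r : Tm → Tm) (C d : Tm) : Tm → Tm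
  | .pair a b => r (d.inst₂Rec a b)
  | p => .sigInd (r C) (r d) p

noncomputable def nfSumInd (r : Tm → Tm) (C l r' : Tm) : Tm → Tm
  | .inl a => r (l.instRec a)
  | .inr b => r (r'.instRec b)
  | s => .sumInd (r C) (r l) (r r') s

noncomputable def nfIdInd (r : Tm → Tm) (C c : Tm) : Tm → Tm
  | .refl _ => r c
  | p => .idInd (r C) (r c) p

noncomputable def nfGqInd (r : Tm → Tm) (P p q : Tm) : Tm → Tm
  | .gqPt v => r (p.instRec v)
  | x => .gqInd (r P) (r p) (r q) x

/-- Normalization of a term, given the normalization `r` of smaller terms. -/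
noncomputable def nfStep : Tm → (Tm → Tm) → Tm
  | .pi A B, r => .pi (r A) (r B)
  | .lam A t, r => .lam (r A) (r t)
  | .app f a, r => nfApp r a (r f)
  | .sig A B, r => .sig (r A) (r B)
  | .pair a b, r => .pair (r a) (r b)
  | .sigInd C d p, r => nfSigInd r C d (r p)
  | .sum A B, r => .sum (r A) (r B)
  | .inl a, r => .inl (r a)
  | .inr b, r => .inr (r b)
  | .sumInd C l r' s, r => nfSumInd r C l r' (r s)
  | .id A a b, r => .id (r A) (r a) (r b)
  | .refl a, r => .refl (r a)
  | .idInd C c p, r => nfIdInd r C c (r p)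
  | .gq V E, r => .gq (r V) (r E)
  | .gqPt v, r => .gqPt (r v)
  | .gqEdge i j e, r => .gqEdge (r i) (r j) (r e)
  | .gqInd P p q x, r => nfGqInd r P p q (r x)
  | t, _ => t

/-- Normalization with respect to the computation rules, with recursion depth bounded by `n`. -/
noncomputable def Tm.nf (n : ℕ) : Tm → Tm :=
  Nat.rec (fun t => t) (fun _ r t => nfStep t r) n

/-- The head is replaced by its normal form first; then either a computation rule fires and the
contractum is normalized, or the remaining components are normalized by congruence. -/
theorem conv_nfStep {r : Tm → Tm} (h : ∀ t, Conv t (r t)) (t : Tm) : Conv t (nfStep t r) := by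
  cases t
  case app f a =>
    refine .trans (.app (h f) (.rfl a)) ?_
    simp only [nfStep]
    generalize r f = f'
    unfold nfApp
    split
    · rw [instRec_eq]; exact .trans (.beta ..) (h _)
    · exact .app (.rfl _) (h a)
  case sigInd C d p =>
    refine .trans (.sigInd (.rfl C) (.rfl d) (h p)) ?_
    simp only [nfStep]
    generalize r p = p'
    unfold nfSigInd
    split
    · rw [inst₂Rec_eq]; exact .trans (.sigInd_pair ..) (h _)
    · exact .sigInd (h C) (h d) (.rfl _)
  case sumInd C l r' s =>
    refine .trans (.sumInd (.rfl C) (.rfl l) (.rfl r') (h s)) ?_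
    simp only [nfStep]
    generalize r s = s'
    unfold nfSumInd
    split
    · rw [instRec_eq]; exact .trans (.sumInd_inl ..) (h _)
    · rw [instRec_eq]; exact .trans (.sumInd_inr ..) (h _)
    · exact .sumInd (h C) (h l) (h r') (.rfl _)
  case idInd C c p =>
    refine .trans (.idInd (.rfl C) (.rfl c) (h p)) ?_
    simp only [nfStep]
    generalize r p = p'
    unfold nfIdInd
    split
    · exact .trans (.idInd_refl ..) (h _)
    · exact .idInd (h C) (h c) (.rfl _)
  case gqInd P p q x =>
    refine .trans (.gqInd (.rfl P) (.rfl p) (.rfl q) (h x)) ?_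
    simp only [nfStep]
    generalize r x = x'
    unfold nfGqInd
    split
    · rw [instRec_eq]; exact .trans (.gqInd_pt ..) (h _)
    · exact .gqInd (h P) (h p) (h q) (.rfl _)
  case pi => exact .pi (h _) (h _)
  case lam => exact .lam (h _) (h _)
  case sig => exact .sig (h _) (h _)
  case pair => exact .pair (h _) (h _)
  case sum => exact .sum (h _) (h _)
  case inl => exact .inl (h _)
  case inr => exact .inr (h _)
  case id => exact .id (h _) (h _) (h _)
  case refl => exact .refl (h _)
  case gq => exact .gq (h _) (h _)
  case gqPt => exact .gqPt (h _)
  case gqEdge => exact .gqEdge (h _) (h _) (h _)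
  all_goals exact .rfl _

theorem Tm.conv_nf (n : ℕ) (t : Tm) : Conv t (nf n t) := by
  induction n generalizing t with
  | zero => exact .rfl t
  | succ n ih => exact conv_nfStep ih t

/-- A sound test for convertibility. -/
noncomputable def Tm.convb (t u : Tm) : Bool := t.eqb u || (nf 1000 t).eqb (nf 1000 u)

theorem Tm.conv_of_convb {t u : Tm} (h : t.convb u = true) : Conv t u := by
  rcases Bool.or_eq_true_iff.1 h with h | h
  · rw [eq_of_eqb _ _ h]; exact .rfl u
  · have := conv_nf 1000 t
    rw [eq_of_eqb _ _ h] at this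
    exact .trans this (.symm (conv_nf _ u))

end MLTT

/-! ### Bidirectional inference and checking of types. -/

namespace MLTT
open Tm Judgement

section

/-- `o`, provided that the test `b` succeeds -/
def ensure (b : Bool) (o : Option Tm) : Option Tm := bif b then o else none

@[simp] theorem ensure_eq_some {b : Bool} {o : Option Tm} {T : Tm} :
    ensure b o = some T ↔ b = true ∧ o = some T := by
  cases b <;> simp [ensure]

def asSort : Tm → Option Size
  | .sort s => some s
  | _ => none

def asPi : Tm → Option (Tm × Tm)
  | .pi A B => some (A, B)
  | _ => none

def asSig : Tm → Option (Tm × Tm)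
  | .sig A B => some (A, B)
  | _ => none

def asSum : Tm → Option (Tm × Tm)
  | .sum A B => some (A, B)
  | _ => none

def asId : Tm → Option (Tm × Tm × Tm)
  | .id A a b => some (A, a, b)
  | _ => none

def asGq : Tm → Option (Tm × Tm)
  | .gq V E => some (V, E)
  | _ => none

def notLarge : Tm → Bool
  | .sort .large => false
  | _ => true

variable {T A B a b V E : Tm} {s : Size}

@[simp] theorem asSort_eq_some : asSort T = some s ↔ T = .sort s := by
  cases T <;> simp [asSort]

@[simp] theorem asPi_eq_some : asPi T = some (A, B) ↔ T = .pi A B := by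
  cases T <;> simp [asPi]

@[simp] theorem asSig_eq_some : asSig T = some (A, B) ↔ T = .sig A B := by
  cases T <;> simp [asSig]

@[simp] theorem asSum_eq_some : asSum T = some (A, B) ↔ T = .sum A B := by
  cases T <;> simp [asSum]

@[simp] theorem asId_eq_some : asId T = some (A, a, b) ↔ T = .id A a b := by
  cases T <;> simp [asId]

@[simp] theorem asGq_eq_some : asGq T = some (V, E) ↔ T = .gq V E := by
  cases T <;> simp [asGq]

theorem ne_large (h : notLarge T = true) : T ≠ .sort .large := by
  rintro rfl; cases h

/-- The size of a dependent product or sum. -/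
def Size.join : Size → Size → Size
  | .small, .small => .small
  | _, _ => .large

/-- The type `T` of a term, if it agrees with the type that is expected. -/
noncomputable def agree : Option Tm → Tm → Option Tm
  | none, T => some T
  | some (.sort .large), T => (asSort T).bind fun _ => some (.sort .large)
  | some T', T => ensure (T.convb T') (some T')

end

/-- The type of a variable, before weakening. -/
noncomputable def lookup (Γ : List Tm) : ℕ → Option Tm :=
  List.rec (fun _ => none) (fun A _ ih n => Nat.rec (some A) (fun n _ => ih n) n) Γ

theorem lookup_eq (Γ : List Tm) (n : ℕ) : lookup Γ n = Γ[n]? := by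
  induction Γ generalizing n with
  | nil => rfl
  | cons A Γ ih =>
    cases n
    · rfl
    · exact ih _

/-! The rules of the type checker.  The arguments `a'`, `A'`, … stand for the runs of the type
checker on the components `a`, `A`, … of a term. -/

/-- A run of the type checker on a term, in a given context, with a type that is expected. -/
abbrev Run := List Tm → Option Tm → Option Tm

/-- The rule for dependent products and sums. -/
noncomputable def checkBinder (A : Tm) (A' B' : Run) : Run := fun Γ e =>
  (A' Γ none).bind fun S => (asSort S).bind fun s =>
  (B' (A :: Γ) none).bind fun S' => (asSort S').bind fun s' =>
  agree e (sort (s.join s'))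

noncomputable def checkSum (A' B' : Run) : Run := fun Γ e =>
  (A' Γ none).bind fun S => (asSort S).bind fun s =>
  (B' Γ none).bind fun S' => (asSort S').bind fun s' =>
  agree e (sort (s.join s'))

noncomputable def inferLam (A : Tm) (A' t' : Run) (Γ : List Tm) : Option Tm :=
  (A' Γ (some (sort .large))).bind fun _ =>
  (t' (A :: Γ) none).bind fun B =>
  ensure (notLarge B) (some (.pi A B))

noncomputable def checkLam (A : Tm) (A' t' : Run) (Γ : List Tm) (T : Tm) : Option Tm :=
  (asPi T).bind fun (A₀, B) =>
  (A' Γ (some (sort .large))).bind fun _ =>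
  ensure (A.convb A₀) <|
  (t' (A :: Γ) (some B)).bind fun _ => some T

/-- The non-dependent rule for `(λ (x : A), t) a`. -/
noncomputable def checkLet (A : Tm) (A' t' a' : Run) (Γ : List Tm) (T : Tm) : Option Tm :=
  (A' Γ (some (sort .large))).bind fun _ => (a' Γ (some A)).bind fun _ =>
  ensure (notLarge T) <| (t' (A :: Γ) (some (T.wkRec 1))).bind fun _ => some T

noncomputable def checkApp (a : Tm) (f' a' : Run) : Run := fun Γ e =>
  (f' Γ none).bind fun T => (asPi T).bind fun (A, B) =>
  (a' Γ (some A)).bind fun _ => agree e (B.instRec a)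

noncomputable def checkPair (a : Tm) (a' b' : Run) (Γ : List Tm) (T : Tm) : Option Tm :=
  (asSig T).bind fun (A, B) =>
  (a' Γ (some A)).bind fun _ => (b' Γ (some (B.instRec a))).bind fun _ => some T

noncomputable def checkSigInd (C p : Tm) (C' d' p' : Run) : Run := fun Γ e =>
  (p' Γ none).bind fun T => (asSig T).bind fun (A, B) =>
  (C' (T :: Γ) (some (sort .large))).bind fun _ =>
  (d' (B :: A :: Γ)
    (some (C.substRec (sconsRec (.pair (.var 1) (.var 0)) (shift 2))))).bind fun _ =>
  agree e (C.instRec p)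

noncomputable def checkInl (a' : Run) (Γ : List Tm) (T : Tm) : Option Tm :=
  (asSum T).bind fun (A, _) => (a' Γ (some A)).bind fun _ => some T

noncomputable def checkInr (b' : Run) (Γ : List Tm) (T : Tm) : Option Tm :=
  (asSum T).bind fun (_, B) => (b' Γ (some B)).bind fun _ => some T

noncomputable def checkSumInd (C s : Tm) (C' l' r' s' : Run) : Run := fun Γ e =>
  (s' Γ none).bind fun T => (asSum T).bind fun (A, B) =>
  (C' (T :: Γ) (some (sort .large))).bind fun _ =>
  (l' (A :: Γ) (some (C.substRec (sconsRec (.inl (.var 0)) (shift 1))))).bind fun _ =>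
  (r' (B :: Γ) (some (C.substRec (sconsRec (.inr (.var 0)) (shift 1))))).bind fun _ =>
  agree e (C.instRec s)

noncomputable def checkId (A : Tm) (A' a' b' : Run) : Run := fun Γ e =>
  (A' Γ none).bind fun S => (asSort S).bind fun s =>
  (a' Γ (some A)).bind fun _ => (b' Γ (some A)).bind fun _ => agree e (sort s)

noncomputable def checkRefl (a : Tm) (a' : Run) (Γ : List Tm) (T : Tm) : Option Tm :=
  (asId T).bind fun (A, x, y) => (a' Γ (some A)).bind fun _ =>
  ensure (a.convb x) <| ensure (a.convb y) (some T)

noncomputable def checkIdInd (C p : Tm) (C' c' p' : Run) : Run := fun Γ e =>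
  (p' Γ none).bind fun T => (asId T).bind fun (A, a, b) =>
  (C' (.id (A.wkRec 1) (a.wkRec 1) (.var 0) :: A :: Γ) (some (sort .large))).bind fun _ =>
  (c' Γ (some (C.inst₂Rec a (.refl a)))).bind fun _ =>
  agree e (C.inst₂Rec b p)

noncomputable def checkGq (V : Tm) (V' E' : Run) : Run := fun Γ e =>
  (V' Γ (some U)).bind fun _ => (E' (V.wkRec 1 :: V :: Γ) (some U)).bind fun _ => agree e U

noncomputable def checkGqPt (v' : Run) (Γ : List Tm) (T : Tm) : Option Tm :=
  (asGq T).bind fun (V, _) => (v' Γ (some V)).bind fun _ => some T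

noncomputable def checkGqEdge (i j : Tm) (i' j' e' : Run) (Γ : List Tm) (T : Tm) : Option Tm :=
  (asId T).bind fun (G, x, y) => (asGq G).bind fun (V, E) =>
  (i' Γ (some V)).bind fun _ => (j' Γ (some V)).bind fun _ =>
  (e' Γ (some (E.inst₂Rec i j))).bind fun _ =>
  ensure ((gqPt i).convb x) <| ensure ((gqPt j).convb y) (some T)

noncomputable def checkGqInd (P p x : Tm) (P' p' q' x' : Run) : Run := fun Γ e =>
  (x' Γ none).bind fun G => (asGq G).bind fun (V, E) =>
  (P' (G :: Γ) (some (sort .large))).bind fun _ =>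
  (p' (V :: Γ) (some (P.substRec (sconsRec (.gqPt (.var 0)) (shift 1))))).bind fun _ =>
  (q' (E :: V.wkRec 1 :: V :: Γ) (some (gqEdgeCase P p))).bind fun _ =>
  agree e (P.instRec x)

noncomputable def checkGqComp (P p q V E i j e : Tm) (P' p' q' V' E' i' g' j' e' : Run)
    (Γ : List Tm) (T : Tm) : Option Tm :=
  (V' Γ (some U)).bind fun _ => (E' (V.wkRec 1 :: V :: Γ) (some U)).bind fun _ =>
  (P' (.gq V E :: Γ) (some (sort .large))).bind fun _ =>
  (p' (V :: Γ) (some (P.substRec (sconsRec (.gqPt (.var 0)) (shift 1))))).bind fun _ =>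
  (q' (E :: V.wkRec 1 :: V :: Γ) (some (gqEdgeCase P p))).bind fun _ =>
  (i' (.gq V E :: Γ) (some (V.wkRec 1))).bind fun _ =>
  (g' Γ (some (.gq V E))).bind fun _ =>
  (j' Γ (some V)).bind fun _ =>
  (e' Γ (some (E.inst₂Rec i j))).bind fun _ =>
  ensure (notLarge T) <|
  ensure ((.id ((gqEdgeCase P p).inst₃ i j e)
        (apd P
          (gqInd (P.rename (up (fun n => n + 1))) (p.rename (up (fun n => n + 1)))
            (q.rename (up (up (up (fun n => n + 1))))) (var 0))
          (gqPt i) (gqEdge i j e))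
        (q.inst₃ i j e) : Tm).convb T) (some T)

noncomputable def checkUa (A B : Tm) (A' B' : Run) (Γ : List Tm) (T : Tm) : Option Tm :=
  (A' Γ (some U)).bind fun _ => (B' Γ (some U)).bind fun _ =>
  ensure (notLarge T) <|
  ensure ((isEquiv (.id U A B) (equiv A B) (idToEquiv A B)).convb T) (some T)

/-- A bidirectional type checker.  `check t Γ none` infers a type of `t` in the context `Γ`, and
`check t Γ (some T)` checks that `t` has type `T`; the result is the type of `t`.

In `gqComp` the vertex `i` has to be given in the form `(λ (_ : gq V E), i') g`, from which the
graph is read off. -/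
noncomputable def check : Tm → Run
  | .var n, Γ, e => (lookup Γ n).bind fun A => agree e (A.wkRec (n + 1))
  | .sort .small, _, e => agree e (sort .large)
  | .pi A B, Γ, e => checkBinder A (check A) (check B) Γ e
  | .lam A t, Γ, none => inferLam A (check A) (check t) Γ
  | .lam A t, Γ, some T => checkLam A (check A) (check t) Γ T
  | .app (.lam A t) a, Γ, some T => checkLet A (check A) (check t) (check a) Γ T
  | .app f a, Γ, e => checkApp a (check f) (check a) Γ e
  | .sig A B, Γ, e => checkBinder A (check A) (check B) Γ e
  | .pair a b, Γ, some T => checkPair a (check a) (check b) Γ T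
  | .sigInd C d p, Γ, e => checkSigInd C p (check C) (check d) (check p) Γ e
  | .sum A B, Γ, e => checkSum (check A) (check B) Γ e
  | .inl a, Γ, some T => checkInl (check a) Γ T
  | .inr b, Γ, some T => checkInr (check b) Γ T
  | .sumInd C l r s, Γ, e => checkSumInd C s (check C) (check l) (check r) (check s) Γ e
  | .id A a b, Γ, e => checkId A (check A) (check a) (check b) Γ e
  | .refl a, Γ, some T => checkRefl a (check a) Γ T
  | .idInd C c p, Γ, e => checkIdInd C p (check C) (check c) (check p) Γ e
  | .gq V E, Γ, e => checkGq V (check V) (check E) Γ e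
  | .gqPt v, Γ, some T => checkGqPt (check v) Γ T
  | .gqEdge i j e, Γ, some T => checkGqEdge i j (check i) (check j) (check e) Γ T
  | .gqInd P p q x, Γ, e => checkGqInd P p x (check P) (check p) (check q) (check x) Γ e
  | .gqComp P p q (.app (.lam (.gq V E) i') g) j e, Γ, some T =>
    checkGqComp P p q V E (.app (.lam (.gq V E) i') g) j e (check P) (check p) (check q)
      (check V) (check E) (check i') (check g) (check j) (check e) Γ T
  | .ua A B, Γ, some T => checkUa A B (check A) (check B) Γ T
  | _, _, _ => none

/-- `T` is a type, or the judgement form `sort large`. -/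
def IsTypeOrLarge (Γ : List Tm) (T : Tm) : Prop :=
  T = .sort .large ∨ Derivable (typing Γ T (sort .large))

/-- The meaning of a successful run of the type checker on `t`. -/
def Sound (t : Tm) : Prop :=
  ∀ Γ e T, check t Γ e = some T → Derivable (ctx Γ) → (∀ T', e = some T' → IsTypeOrLarge Γ T') →
    Derivable (typing Γ t T) ∧ IsTypeOrLarge Γ T ∧ ∀ T', e = some T' → T' = T

/-! ### Soundness of the type checker, one rule at a time. -/

section
variable {Γ : List Tm} {t T T' A B C a b p u V E : Tm} {e : Option Tm} {s : Size}

theorem IsTypeOrLarge.isType (h : IsTypeOrLarge Γ T) (hT : T ≠ .sort .large) :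
    Derivable (typing Γ T (sort .large)) := h.resolve_left hT

/-- Against `sort large` the inclusion of small types is used; against any other expected type the
conversion rule is used, whose side condition holds since that expression is then a genuine type. -/
theorem agree_sound (h : agree e T = some T') (ht : Derivable (typing Γ t T))
    (hT : IsTypeOrLarge Γ T) (he : ∀ T'', e = some T'' → IsTypeOrLarge Γ T'') :
    Derivable (typing Γ t T') ∧ IsTypeOrLarge Γ T' ∧ ∀ T'', e = some T'' → T'' = T' := by
  unfold agree at h
  split at h
  · obtain rfl : T = T' := by simpa using h
    exact ⟨ht, hT, fun _ h => by cases h⟩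
  · simp only [Option.bind_eq_some_iff, asSort_eq_some] at h
    obtain ⟨s, rfl, h⟩ := h
    cases h
    exact ⟨ht.large, .inl rfl, fun T'' h => by simpa using h.symm⟩
  next S _ hS =>
    obtain ⟨hc, h⟩ := ensure_eq_some.1 h
    cases h
    refine ⟨.conv ht (conv_of_convb hc) ((he _ rfl).isType fun h => hS (by rw [h])), he _ rfl,
      fun T'' h => by simpa using h.symm⟩

theorem Sound.infer (h : Sound t) (hΓ : Derivable (ctx Γ)) (hc : check t Γ none = some T) :
    Derivable (typing Γ t T) ∧ IsTypeOrLarge Γ T :=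
  have := h _ _ _ hc hΓ fun _ h => by cases h
  ⟨this.1, this.2.1⟩

theorem Sound.check (h : Sound t) (hΓ : Derivable (ctx Γ)) (hA : IsTypeOrLarge Γ A)
    (hc : check t Γ (some A) = some T) : Derivable (typing Γ t A) := by
  obtain ⟨h, -, e⟩ := h _ _ _ hc hΓ fun T' h => by cases h; exact hA
  rwa [e A rfl]

theorem Sound.checkType (h : Sound t) (hΓ : Derivable (ctx Γ))
    (hc : MLTT.check t Γ (some (sort .large)) = some T) :
    Derivable (typing Γ t (sort .large)) :=
  h.check hΓ (.inl rfl) hc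

theorem isTypeOrLarge_sort (hΓ : Derivable (ctx Γ)) (s : Size) : IsTypeOrLarge Γ (.sort s) := by
  cases s
  · exact .inr (.univ hΓ)
  · exact .inl rfl

theorem Sound.checkSmall (h : Sound t) (hΓ : Derivable (ctx Γ))
    (hc : MLTT.check t Γ (some U) = some T) : Derivable (typing Γ t U) :=
  h.check hΓ (isTypeOrLarge_sort hΓ .small) hc

theorem sound_some (he : ∀ T', some T = some T' → IsTypeOrLarge Γ T')
    (ht : Derivable (typing Γ t T)) :
    Derivable (typing Γ t T) ∧ IsTypeOrLarge Γ T ∧ ∀ T', some T = some T' → T' = T :=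
  ⟨ht, he _ rfl, fun T' h => by simpa using h.symm⟩

theorem Derivable.sort_join_left {s' : Size} (h : Derivable (typing Γ A (sort s))) :
    Derivable (typing Γ A (sort (s.join s'))) := by
  cases s <;> cases s' <;> first | exact h | exact h.large

theorem Derivable.sort_join_right {s' : Size} (h : Derivable (typing Γ A (sort s))) :
    Derivable (typing Γ A (sort (Size.join s' s))) := by
  cases s <;> cases s' <;> first | exact h | exact h.large

/-- All final segments of the context are contexts. -/
def ValidCtx : List Tm → Prop
  | [] => True
  | A :: Γ => Derivable (ctx (A :: Γ)) ∧ ValidCtx Γ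

/-- The context of a judgement. -/
def Judgement.context : Judgement → List Tm
  | ctx Γ => Γ
  | typing Γ _ _ => Γ

theorem Derivable.validCtx {J : Judgement} (h : Derivable J) : ValidCtx J.context := by
  induction h
  case nil => trivial
  case cons h ih => exact ⟨.cons h, ih⟩
  all_goals first | assumption | exact And.right (by assumption)

theorem ValidCtx.ctx (h : ValidCtx Γ) : Derivable (ctx Γ) := by
  cases Γ
  · exact .nil
  · exact h.1

theorem Derivable.lookup {n : ℕ} (hΓ : Derivable (ctx Γ)) (hn : Γ[n]? = some A) :
    Derivable (typing Γ (A.wk (n + 1)) (sort .large)) := by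
  induction Γ generalizing n with
  | nil => simp at hn
  | cons B Γ ih =>
    have hB := hΓ.ctx_tail
    cases n with
    | zero =>
      obtain rfl : B = A := by simpa using hn
      exact hB.wk_one hB
    | succ n =>
      have e : A.wk (n + 1 + 1) = (A.wk (n + 1)).wk 1 := (wk_wk ..).symm
      rw [e]
      exact (ih hB.validCtx.ctx (by simpa using hn)).wk_one hB

theorem sound_var (n : ℕ) : Sound (.var n) := by
  intro Γ e T h hΓ he
  simp only [check, wkRec_eq, lookup_eq, Option.bind_eq_some_iff] at h
  obtain ⟨A, hA, h⟩ := h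
  exact agree_sound h (.var hΓ hA) (.inr (hΓ.lookup hA)) he

theorem sound_sort : Sound (.sort .small) := by
  intro Γ e T h hΓ he
  exact agree_sound h (.univ hΓ) (.inl rfl) he

theorem sound_pi (hA : Sound A) (hB : Sound B) : Sound (.pi A B) := by
  intro Γ e T h hΓ he
  simp only [MLTT.check, checkBinder, Option.bind_eq_some_iff, asSort_eq_some] at h
  obtain ⟨_, h₁, s, rfl, _, h₂, s', rfl, h⟩ := h
  have h₁ := (hA.infer hΓ h₁).1
  have h₂ := (hB.infer (.cons h₁.large) h₂).1
  exact agree_sound h (.pi h₁.sort_join_left h₂.sort_join_right) (isTypeOrLarge_sort hΓ _) he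

theorem sound_sig (hA : Sound A) (hB : Sound B) : Sound (.sig A B) := by
  intro Γ e T h hΓ he
  simp only [MLTT.check, checkBinder, Option.bind_eq_some_iff, asSort_eq_some] at h
  obtain ⟨_, h₁, s, rfl, _, h₂, s', rfl, h⟩ := h
  have h₁ := (hA.infer hΓ h₁).1
  have h₂ := (hB.infer (.cons h₁.large) h₂).1
  exact agree_sound h (.sig h₁.sort_join_left h₂.sort_join_right) (isTypeOrLarge_sort hΓ _) he

theorem sound_sum (hA : Sound A) (hB : Sound B) : Sound (.sum A B) := by
  intro Γ e T h hΓ he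
  simp only [MLTT.check, checkSum, Option.bind_eq_some_iff, asSort_eq_some] at h
  obtain ⟨_, h₁, s, rfl, _, h₂, s', rfl, h⟩ := h
  have h₁ := (hA.infer hΓ h₁).1
  have h₂ := (hB.infer hΓ h₂).1
  exact agree_sound h (.sum h₁.sort_join_left h₂.sort_join_right) (isTypeOrLarge_sort hΓ _) he

theorem sound_lam (hA : Sound A) (ht : Sound t) : Sound (.lam A t) := by
  intro Γ e T h hΓ he
  cases e with
  | none =>
    simp only [MLTT.check, inferLam, Option.bind_eq_some_iff, ensure_eq_some] at h
    obtain ⟨_, h₁, B, h₂, hB, h⟩ := h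
    cases h
    have h₁ := hA.checkType hΓ h₁
    have h₂ := ht.infer (.cons h₁) h₂
    have h₃ := h₂.2.isType (ne_large hB)
    exact ⟨.lam h₃ h₂.1, .inr (.pi h₁ h₃), fun _ h => by cases h⟩
  | some T' =>
    simp only [MLTT.check, checkLam, Option.bind_eq_some_iff, ensure_eq_some, Prod.exists,
      asPi_eq_some] at h
    obtain ⟨A', B, rfl, _, h₁, hc, _, h₂, h⟩ := h
    cases h
    refine sound_some he ?_
    have hT := (he _ rfl).isType (by simp)
    obtain ⟨hA', hB⟩ : _ ∧ _ := hT.components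
    have h₁ := hA.checkType hΓ h₁
    have hc := conv_of_convb hc
    -- The annotated domain `A` is only convertible to the expected domain `A'`. The codomain is
    -- moved between the two contexts by the identity substitution, with variable `0` retyped by
    -- conversion.
    have hB' : Derivable (typing (A :: Γ) B (sort .large)) := by
      have hs : IsSubst (A' :: Γ) (A :: Γ) (scons (var 0) (shift 1)) :=
        (isSubst_shift [A] (.cons h₁)).scons <| by
          have e : A'.subst (shift [A].length) = A'.wk 1 := (rename_eq_subst ..).symm
          rw [e]
          refine .conv (.var (.cons h₁) rfl) ?_ (hA'.wk_one h₁)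
          simpa only [wk, rename_eq_subst] using hc.subst _
      have e : scons (var 0) (shift 1) = var := by funext n; cases n <;> rfl
      simpa only [e, subst_var] using hB.subst hs (.cons h₁)
    exact .conv (.lam hB' (ht.check (.cons h₁) (.inr hB') h₂)) (.pi hc (.rfl B)) hT

theorem sound_app_infer (hf : Sound t) (ha : Sound a)
    (h : checkApp a (MLTT.check t) (MLTT.check a) Γ e = some T)
    (hΓ : Derivable (ctx Γ)) (he : ∀ T', e = some T' → IsTypeOrLarge Γ T') :
    Derivable (typing Γ (.app t a) T) ∧ IsTypeOrLarge Γ T ∧ ∀ T', e = some T' → T' = T := by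
  simp only [checkApp, Option.bind_eq_some_iff, Prod.exists, asPi_eq_some, instRec_eq] at h
  obtain ⟨_, h₁, A, B, rfl, _, h₂, h⟩ := h
  obtain ⟨h₁, hT⟩ := hf.infer hΓ h₁
  obtain ⟨hA, hB⟩ : _ ∧ _ := (hT.isType (by simp)).components
  have h₂ := ha.check hΓ (.inr hA) h₂
  exact agree_sound h (.app h₁ h₂) (.inr (hB.inst hΓ h₂)) he

theorem sound_app (ht : ∀ A u, t ≠ .lam A u) (hf : Sound t) (ha : Sound a) :
    Sound (.app t a) := by
  intro Γ e T h hΓ he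
  rw [MLTT.check] at h
  · exact sound_app_infer hf ha h hΓ he
  · exact fun A u _ hu _ => ht A u (by assumption)

theorem sound_app_lam (hA : Sound A) (ht : Sound t) (ha : Sound a) :
    Sound (.app (.lam A t) a) := by
  intro Γ e T h hΓ he
  cases e with
  | none =>
    rw [MLTT.check] at h
    · exact sound_app_infer (sound_lam hA ht) ha h hΓ he
    · simp
  | some T' =>
    simp only [MLTT.check, checkLet, wkRec_eq, Option.bind_eq_some_iff, ensure_eq_some] at h
    obtain ⟨_, h₁, _, h₂, hT, _, h₃, h⟩ := h
    cases h
    refine sound_some he ?_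
    have hT := (he _ rfl).isType (ne_large hT)
    have h₁ := hA.checkType hΓ h₁
    have h₂ := ha.check hΓ (.inr h₁) h₂
    have hT₁ := hT.wk_one h₁
    have := Derivable.app (.lam hT₁ (ht.check (.cons h₁) (.inr hT₁) h₃)) h₂
    rwa [wk_inst] at this

theorem sound_pair (ha : Sound a) (hb : Sound b) : Sound (.pair a b) := by
  intro Γ e T h hΓ he
  cases e with
  | none => simp [MLTT.check] at h
  | some T' =>
    simp only [MLTT.check, checkPair, instRec_eq, Option.bind_eq_some_iff, Prod.exists,
      asSig_eq_some] at h
    obtain ⟨A, B, rfl, _, h₁, _, h₂, h⟩ := h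
    cases h
    refine sound_some he ?_
    obtain ⟨hA, hB⟩ : _ ∧ _ := ((he _ rfl).isType (by simp)).components
    have h₁ := ha.check hΓ (.inr hA) h₁
    exact .pair hB h₁ (hb.check hΓ (.inr (hB.inst hΓ h₁)) h₂)

theorem sound_inl (ha : Sound a) : Sound (.inl a) := by
  intro Γ e T h hΓ he
  cases e with
  | none => simp [MLTT.check] at h
  | some T' =>
    simp only [MLTT.check, checkInl, Option.bind_eq_some_iff, Prod.exists, asSum_eq_some] at h
    obtain ⟨A, B, rfl, _, h₁, h⟩ := h
    cases h
    refine sound_some he ?_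
    obtain ⟨hA, hB⟩ : _ ∧ _ := ((he _ rfl).isType (by simp)).components
    exact .inl hA hB (ha.check hΓ (.inr hA) h₁)

theorem sound_inr (ha : Sound a) : Sound (.inr a) := by
  intro Γ e T h hΓ he
  cases e with
  | none => simp [MLTT.check] at h
  | some T' =>
    simp only [MLTT.check, checkInr, Option.bind_eq_some_iff, Prod.exists, asSum_eq_some] at h
    obtain ⟨A, B, rfl, _, h₁, h⟩ := h
    cases h
    refine sound_some he ?_
    obtain ⟨hA, hB⟩ : _ ∧ _ := ((he _ rfl).isType (by simp)).components
    exact .inr hA hB (ha.check hΓ (.inr hB) h₁)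

theorem sound_refl (ha : Sound a) : Sound (.refl a) := by
  intro Γ e T h hΓ he
  cases e with
  | none => simp [MLTT.check] at h
  | some T' =>
    simp only [MLTT.check, checkRefl, Option.bind_eq_some_iff, Prod.exists, asId_eq_some,
      ensure_eq_some] at h
    obtain ⟨A, x, y, rfl, _, h₁, hx, hy, h⟩ := h
    cases h
    refine sound_some he ?_
    have hT := (he _ rfl).isType (by simp)
    obtain ⟨hA, -, -⟩ : _ ∧ _ ∧ _ := hT.components
    exact .conv (.refl hA (ha.check hΓ (.inr hA) h₁))
      (.id (.rfl A) (conv_of_convb hx) (conv_of_convb hy)) hT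

theorem sound_gqPt (ha : Sound a) : Sound (.gqPt a) := by
  intro Γ e T h hΓ he
  cases e with
  | none => simp [MLTT.check] at h
  | some T' =>
    simp only [MLTT.check, checkGqPt, Option.bind_eq_some_iff, Prod.exists, asGq_eq_some] at h
    obtain ⟨V, E, rfl, _, h₁, h⟩ := h
    cases h
    refine sound_some he ?_
    obtain ⟨hV, hE⟩ : _ ∧ _ := ((he _ rfl).isType (by simp)).components
    exact .gqPt hV hE (ha.check hΓ (.inr (.incl hV)) h₁)

theorem Derivable.edgeType {i j : Tm} (hΓ : Derivable (ctx Γ))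
    (hE : Derivable (typing (V.wk 1 :: V :: Γ) E U)) (hi : Derivable (typing Γ i V))
    (hj : Derivable (typing Γ j V)) : Derivable (typing Γ (E.inst₂ i j) U) :=
  hE.inst₂ hΓ hi (by rwa [wk_inst])

theorem sound_gqEdge {i j x : Tm} (hi : Sound i) (hj : Sound j) (hx : Sound x) :
    Sound (.gqEdge i j x) := by
  intro Γ e T h hΓ he
  cases e with
  | none => simp [MLTT.check] at h
  | some T' =>
    simp only [MLTT.check, checkGqEdge, inst₂Rec_eq, Option.bind_eq_some_iff, Prod.exists,
      asGq_eq_some, asId_eq_some,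
      ensure_eq_some] at h
    obtain ⟨G, a, b, rfl, V, E, rfl, _, h₁, _, h₂, _, h₃, ca, cb, h⟩ := h
    cases h
    refine sound_some he ?_
    have hT := (he _ rfl).isType (by simp)
    obtain ⟨hG, -, -⟩ : _ ∧ _ ∧ _ := hT.components
    obtain ⟨hV, hE⟩ : _ ∧ _ := hG.components
    have h₁ := hi.check hΓ (.inr (.incl hV)) h₁
    have h₂ := hj.check hΓ (.inr (.incl hV)) h₂
    have h₃ := hx.check hΓ (.inr (.incl (.edgeType hΓ hE h₁ h₂))) h₃
    exact .conv (.gqEdge hV hE h₁ h₂ h₃)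
      (.id (.rfl _) (conv_of_convb ca) (conv_of_convb cb)) hT

theorem sound_id (hA : Sound A) (ha : Sound a) (hb : Sound b) : Sound (.id A a b) := by
  intro Γ e T h hΓ he
  simp only [MLTT.check, checkId, Option.bind_eq_some_iff, asSort_eq_some] at h
  obtain ⟨_, h₁, s, rfl, _, h₂, _, h₃, h⟩ := h
  have h₁ := (hA.infer hΓ h₁).1
  have h₂ := ha.check hΓ (.inr h₁.large) h₂
  have h₃ := hb.check hΓ (.inr h₁.large) h₃
  exact agree_sound h (.id h₁ h₂ h₃) (isTypeOrLarge_sort hΓ _) he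

theorem sound_gq (hV : Sound V) (hE : Sound E) : Sound (.gq V E) := by
  intro Γ e T h hΓ he
  simp only [MLTT.check, checkGq, wkRec_eq, Option.bind_eq_some_iff] at h
  obtain ⟨_, h₁, _, h₂, h⟩ := h
  have h₁ := hV.checkSmall hΓ h₁
  have hΓ' : Derivable (ctx (V.wk 1 :: V :: Γ)) :=
    .cons ((Derivable.incl h₁).wk_one (.incl h₁))
  exact agree_sound h (.gq h₁ (hE.checkSmall hΓ' h₂)) (isTypeOrLarge_sort hΓ .small) he

theorem sound_ua (hA : Sound A) (hB : Sound B) : Sound (.ua A B) := by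
  intro Γ e T h hΓ he
  cases e with
  | none => simp [MLTT.check] at h
  | some T' =>
    simp only [MLTT.check, checkUa, Option.bind_eq_some_iff, ensure_eq_some] at h
    obtain ⟨_, h₁, _, h₂, hT, hc, h⟩ := h
    cases h
    refine sound_some he ?_
    have ht := Derivable.ua (hA.checkSmall hΓ h₁) (hB.checkSmall hΓ h₂)
    exact .conv ht (conv_of_convb hc) ((he _ rfl).isType (ne_large hT))

theorem sound_sigInd {d : Tm} (hC : Sound C) (hd : Sound d) (hp : Sound p) :
    Sound (.sigInd C d p) := by
  intro Γ e T h hΓ he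
  simp only [MLTT.check, checkSigInd, instRec_eq, substRec_eq, sconsRec_eq,
    Option.bind_eq_some_iff, Prod.exists, asSig_eq_some] at h
  obtain ⟨_, h₁, A, B, rfl, _, h₂, _, h₃, h⟩ := h
  obtain ⟨h₁, hT⟩ := hp.infer hΓ h₁
  have hT := hT.isType (by simp)
  obtain ⟨hA, hB⟩ : _ ∧ _ := hT.components
  have h₂ := hC.checkType (.cons hT) h₂
  have hΔ : Derivable (ctx (B :: A :: Γ)) := .cons hB
  refine agree_sound h (.sigInd h₂ (hd.check hΔ (.inr ?_) h₃) h₁) (.inr (h₂.inst hΓ h₁)) he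
  refine h₂.subst ((isSubst_shift [B, A] hΔ).scons ?_) hΔ
  have hB₂ := (hB.stable isSubst_substClass).under isSubst_substClass
    (isSubst_shift [B, A] hΔ) hΔ
  have v₁ : Derivable (typing (B :: A :: Γ) (.var 1) (A.subst (shift 2))) := by
    have e : A.subst (shift 2) = A.wk 2 := (rename_eq_subst ..).symm
    rw [e]; exact .var hΔ rfl
  refine .pair hB₂ v₁ ?_
  have e : (B.subst (ups (shift 2))).inst (.var 1) = B.wk 1 := by
    rw [Tm.inst, subst_subst, wk, rename_eq_subst]; congr 1; funext n; cases n <;> rfl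
  have e' : [B, A].length = 2 := rfl
  rw [e', e]
  exact .var hΔ rfl

theorem sound_sumInd {l r x : Tm} (hC : Sound C) (hl : Sound l) (hr : Sound r) (hx : Sound x) :
    Sound (.sumInd C l r x) := by
  intro Γ e T h hΓ he
  simp only [MLTT.check, checkSumInd, instRec_eq, substRec_eq, sconsRec_eq,
    Option.bind_eq_some_iff, Prod.exists, asSum_eq_some] at h
  obtain ⟨_, h₁, A, B, rfl, _, h₂, _, h₃, _, h₄, h⟩ := h
  obtain ⟨h₁, hT⟩ := hx.infer hΓ h₁
  have hT := hT.isType (by simp)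
  obtain ⟨hA, hB⟩ : _ ∧ _ := hT.components
  have h₂ := hC.checkType (.cons hT) h₂
  have e : ∀ D : Tm, D.subst (shift 1) = D.wk 1 := fun D => (rename_eq_subst ..).symm
  have hl := hl.check (.cons hA) (.inr (h₂.subst ((isSubst_shift [A] (.cons hA)).scons
    (.inl ((hA.subst (isSubst_shift [A] (.cons hA)) (.cons hA)))
      ((hB.subst (isSubst_shift [A] (.cons hA)) (.cons hA)))
      (by simpa only [List.length_singleton, e] using .var (.cons hA) rfl))) (.cons hA))) h₃
  have hr := hr.check (.cons hB) (.inr (h₂.subst ((isSubst_shift [B] (.cons hB)).scons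
    (.inr ((hA.subst (isSubst_shift [B] (.cons hB)) (.cons hB)))
      ((hB.subst (isSubst_shift [B] (.cons hB)) (.cons hB)))
      (by simpa only [List.length_singleton, e] using .var (.cons hB) rfl))) (.cons hB))) h₄
  exact agree_sound h (.sumInd h₂ hl hr h₁) (.inr (h₂.inst hΓ h₁)) he

theorem sound_idInd {c : Tm} (hC : Sound C) (hc : Sound c) (hp : Sound p) :
    Sound (.idInd C c p) := by
  intro Γ e T h hΓ he
  simp only [MLTT.check, checkIdInd, wkRec_eq, inst₂Rec_eq, Option.bind_eq_some_iff, Prod.exists,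
    asId_eq_some] at h
  obtain ⟨_, h₁, A, a, b, rfl, _, h₂, _, h₃, h⟩ := h
  obtain ⟨h₁, hT⟩ := hp.infer hΓ h₁
  obtain ⟨hA, ha, hb⟩ : _ ∧ _ ∧ _ := (hT.isType (by simp)).components
  have h₂ := hC.checkType (hA.idCtx ha) h₂
  have h₃ := hc.check hΓ (.inr (.inst₂_id hΓ h₂ ha (.refl hA ha))) h₃
  exact agree_sound h (.idInd h₂ h₃ h₁) (.inr (.inst₂_id hΓ h₂ hb h₁)) he

theorem Derivable.pointCase (hV : Derivable (typing Γ V U))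
    (hE : Derivable (typing (V.wk 1 :: V :: Γ) E U))
    {P : Tm} (hP : Derivable (typing (.gq V E :: Γ) P (sort .large))) :
    Derivable (typing (V :: Γ) (P.subst (scons (.gqPt (.var 0)) (shift 1)))
      (sort .large)) := by
  have hΔ : Derivable (ctx (V :: Γ)) := .cons (.incl hV)
  have hs : IsSubst Γ (V :: Γ) (shift 1) := isSubst_shift [V] hΔ
  have hE₁ := (hE.stable isSubst_substClass).under₂ isSubst_substClass hs hΔ
  rw [wk_one_subst_ups] at hE₁
  refine hP.subst (hs.scons (.gqPt (hV.subst hs hΔ) hE₁ ?_)) hΔ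
  have e : V.subst (shift 1) = V.wk 1 := (rename_eq_subst ..).symm
  rw [e]; exact .var hΔ rfl

theorem sound_gqInd {P q x : Tm} (hP : Sound P) (hp : Sound p) (hq : Sound q) (hx : Sound x) :
    Sound (.gqInd P p q x) := by
  intro Γ e T h hΓ he
  simp only [MLTT.check, checkGqInd, wkRec_eq, instRec_eq, substRec_eq, sconsRec_eq,
    Option.bind_eq_some_iff, Prod.exists, asGq_eq_some] at h
  obtain ⟨_, h₁, V, E, rfl, _, h₂, _, h₃, _, h₄, h⟩ := h
  obtain ⟨h₁, hT⟩ := hx.infer hΓ h₁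
  have hT := hT.isType (by simp)
  obtain ⟨hV, hE⟩ : _ ∧ _ := hT.components
  have h₂ := hP.checkType (.cons hT) h₂
  have h₃ := hp.check (.cons (.incl hV)) (.inr (.pointCase hV hE h₂)) h₃
  have h₄ := hq.check (.cons (.incl hE)) (.inr (.gqEdgeCase hV hE h₂ h₃)) h₄
  exact agree_sound h (.gqInd h₂ h₃ h₄ h₁) (.inr (h₂.inst hΓ h₁)) he

theorem sound_gqComp {P q i g j x : Tm} (hV : Sound V) (hE : Sound E) (hP : Sound P)
    (hp : Sound p) (hq : Sound q) (hi : Sound i) (hg : Sound g) (hj : Sound j) (hx : Sound x) :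
    Sound (.gqComp P p q (.app (.lam (.gq V E) i) g) j x) := by
  intro Γ e T h hΓ he
  cases e with
  | none => simp [MLTT.check] at h
  | some T' =>
    simp only [MLTT.check, checkGqComp, wkRec_eq, inst₂Rec_eq, substRec_eq, sconsRec_eq,
      Option.bind_eq_some_iff, ensure_eq_some] at h
    obtain ⟨_, h₁, _, h₂, _, h₃, _, h₄, _, h₅, _, h₆, _, h₇, _, h₈, _, h₉, hT, hc, h⟩ := h
    cases h
    refine sound_some he ?_
    have hV := hV.checkSmall hΓ h₁
    have hE := hE.checkSmall (.cons ((Derivable.incl hV).wk_one (.incl hV))) h₂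
    have hG := Derivable.incl (.gq hV hE)
    have hP := hP.checkType (.cons hG) h₃
    have hp := hp.check (.cons (.incl hV)) (.inr (.pointCase hV hE hP)) h₄
    have hq := hq.check (.cons (.incl hE)) (.inr (.gqEdgeCase hV hE hP hp)) h₅
    have hwk := (Derivable.incl hV).wk_one hG
    have hi := hi.check (.cons hG) (.inr hwk) h₆
    have hg := hg.check hΓ (.inr hG) h₇
    have hi := Derivable.app (.lam hwk hi) hg
    rw [wk_inst] at hi
    have hj := hj.check hΓ (.inr (.incl hV)) h₈
    have hx := hx.check hΓ (.inr (.incl (.edgeType hΓ hE hi hj))) h₉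
    have ht := Derivable.gqComp hP hp hq hi hj hx
    exact .conv ht (conv_of_convb hc) ((he _ rfl).isType (ne_large hT))

/-- Structural recursion over terms. Applications split on whether the head is a literal `λ`, since
checking mode then uses the let rule; `gqComp` splits on whether its source vertex carries the graph
annotation. -/
theorem sound : ∀ t, Sound t
  | .var n => sound_var n
  | .sort .small => sound_sort
  | .pi A B => sound_pi (sound A) (sound B)
  | .lam A t => sound_lam (sound A) (sound t)
  | .app f a => by
    by_cases hf : ∃ A t, f = .lam A t
    · obtain ⟨A, t, rfl⟩ := hf
      exact sound_app_lam (sound A) (sound t) (sound a)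
    · exact sound_app (fun A t h => hf ⟨A, t, h⟩) (sound f) (sound a)
  | .sig A B => sound_sig (sound A) (sound B)
  | .pair a b => sound_pair (sound a) (sound b)
  | .sigInd C d p => sound_sigInd (sound C) (sound d) (sound p)
  | .sum A B => sound_sum (sound A) (sound B)
  | .inl a => sound_inl (sound a)
  | .inr a => sound_inr (sound a)
  | .sumInd C l r s => sound_sumInd (sound C) (sound l) (sound r) (sound s)
  | .id A a b => sound_id (sound A) (sound a) (sound b)
  | .refl a => sound_refl (sound a)
  | .idInd C c p => sound_idInd (sound C) (sound c) (sound p)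
  | .gq V E => sound_gq (sound V) (sound E)
  | .gqPt v => sound_gqPt (sound v)
  | .gqEdge i j e => sound_gqEdge (sound i) (sound j) (sound e)
  | .gqInd P p q x => sound_gqInd (sound P) (sound p) (sound q) (sound x)
  | .gqComp P p q i j e => by
    by_cases hi : ∃ V E i' g, i = .app (.lam (.gq V E) i') g
    · obtain ⟨V, E, i', g, rfl⟩ := hi
      exact sound_gqComp (sound V) (sound E) (sound P) (sound p) (sound q) (sound i') (sound g)
        (sound j) (sound e)
    · intro Γ e' T h
      rw [check] at h
      · cases h
      all_goals grind
  | .ua A B => sound_ua (sound A) (sound B)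
  | .sort .large | .empty | .emptyInd .. | .unit | .star | .unitInd .. | .nat | .zero | .succ _
  | .natInd .. | .funext .. => fun Γ e T h => by simp [check] at h
termination_by t => t

end
end MLTT

/-! ### From successful runs of the checker to closed terms. -/

namespace MLTT

/-- Two runs are needed: checking `t` against `T` proves something only once `T` itself is known to
be a type. -/
theorem hasClosedTerm_of_check {t T : Tm} (hT : (check T [] (some (.sort .large))).isSome = true)
    (ht : (check t [] (some T)).isSome = true) : HasClosedTerm T := by
  obtain ⟨_, hT⟩ := Option.isSome_iff_exists.1 hT
  obtain ⟨_, ht⟩ := Option.isSome_iff_exists.1 ht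
  exact ⟨t, (sound t).check .nil (.inr ((sound T).checkType .nil hT)) ht⟩

/-! ### Terms with named variables -/

/-- Terms in contexts of arbitrary length, to be evaluated at the length of the context. -/
abbrev Term := ℕ → Tm

namespace Term

/-- The variable bound in a context of length `m`. -/
def bound (m : ℕ) : Term := fun n => .var (n - m - 1)

/-- Binders are Lean functions. A bound variable remembers the depth `n` of its binder (a de Bruijn
level) and becomes an index only when read at the depth of its occurrence, so no explicit weakening
is ever written. -/
def bind (f : Term → Term) : Term := fun n => f (bound n) (n + 1)

def bind₂ (f : Term → Term → Term) : Term := fun n => bind (f (bound n)) (n + 1)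

def bind₃ (f : Term → Term → Term → Term) : Term := fun n => bind₂ (f (bound n)) (n + 1)

def univ : Term := fun _ => U

def pi (A : Term) (B : Term → Term) : Term := fun n => .pi (A n) (bind B n)

def lam (A : Term) (t : Term → Term) : Term := fun n => .lam (A n) (bind t n)

def app (f a : Term) : Term := fun n => .app (f n) (a n)

def sig (A : Term) (B : Term → Term) : Term := fun n => .sig (A n) (bind B n)

def pair (a b : Term) : Term := fun n => .pair (a n) (b n)

def sigInd (C : Term → Term) (d : Term → Term → Term) (p : Term) : Term := fun n =>
  .sigInd (bind C n) (bind₂ d n) (p n)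

def sum (A B : Term) : Term := fun n => .sum (A n) (B n)

def inl (a : Term) : Term := fun n => .inl (a n)

def inr (b : Term) : Term := fun n => .inr (b n)

def sumInd (C l r : Term → Term) (s : Term) : Term := fun n =>
  .sumInd (bind C n) (bind l n) (bind r n) (s n)

def id (A a b : Term) : Term := fun n => .id (A n) (a n) (b n)

def refl (a : Term) : Term := fun n => .refl (a n)

def idInd (C : Term → Term → Term) (c p : Term) : Term := fun n =>
  .idInd (bind₂ C n) (c n) (p n)

def gqPt (v : Term) : Term := fun n => .gqPt (v n)

def gqEdge (i j e : Term) : Term := fun n => .gqEdge (i n) (j n) (e n)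

def gqInd (P p : Term → Term) (q : Term → Term → Term → Term) (x : Term) : Term := fun n =>
  .gqInd (bind P n) (bind p n) (bind₃ q n) (x n)

def gqComp (P p : Term → Term) (q : Term → Term → Term → Term) (i j e : Term) : Term := fun n =>
  .gqComp (bind P n) (bind p n) (bind₃ q n) (i n) (j n) (e n)

def ua (A B : Term) : Term := fun n => .ua (A n) (B n)

def arrow (A B : Term) : Term := pi A fun _ => B

def equiv (A B : Term) : Term := fun n => MLTT.equiv (A n) (B n)

def isEquiv (A B f : Term) : Term := fun n => MLTT.isEquiv (A n) (B n) (f n)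

def idToEquiv (A B : Term) : Term := fun n => MLTT.idToEquiv (A n) (B n)

def isProp (A : Term) : Term := fun n => MLTT.isProp (A n)

def isEmb (A X f : Term) : Term := fun n => MLTT.isEmb (A n) (X n) (f n)

def fib (A X f x : Term) : Term := fun n => MLTT.fib (A n) (X n) (f n) (x n)

/-- `t`, with a type annotation that the type checker can read off. -/
def ann (T t : Term) : Term := app (lam T fun x => x) t

/-- The first projection out of `Σ (a : A), _`. -/
def fst (A p : Term) : Term := sigInd (fun _ => A) (fun a _ => a) p

/-- The second projection out of `Σ (a : A), B a`. -/
def snd (A : Term) (B : Term → Term) (p : Term) : Term :=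
  sigInd (fun p => B (fst A p)) (fun _ b => b) p

/-- Transport along `p` in the family `P`. -/
def tr (P : Term → Term) (p u : Term) : Term := idInd (fun y _ => P y) u p

/-- Transport along `p` in the constant family `X` sends `u` to `v`, for `w : u = v`. -/
def trConst (X p u v w : Term) : Term :=
  app (idInd (fun _ p => arrow (id X u v) (id X (tr (fun _ => X) p u) v))
    (lam (id X u v) fun w => w) p) w

/-- The data of a pushout `A +_C B`. -/
structure Span where
  C : Term
  A : Term
  B : Term
  f : Term
  g : Term

/-! ### Pushouts: induction over edges and sections of `inl`. -/

namespace Span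

variable (S : Span)

def pushout : Term := fun n => MLTT.pushout (S.C n) (S.A n) (S.B n) (S.f n) (S.g n)

def left (c : Term) : Term := ann (sum S.A S.B) (inl (app S.f c))

def right (c : Term) : Term := ann (sum S.A S.B) (inr (app S.g c))

/-- The path given by the edge `e : E i j`. -/
def edge (i j e : Term) : Term := ann (id S.pushout (gqPt i) (gqPt j)) (gqEdge i j e)

/-- The edge from `inl x` to `inr y` for `c : C` with `f c ≡ x` and `g c ≡ y`. -/
def glueEdge (c x y : Term) : Term := pair c (pair (refl (inl x)) (refl (inr y)))

/-- The path from `inl x` to `inr y` for `c : C` with `f c ≡ x` and `g c ≡ y`. -/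
def glue (c x y : Term) : Term := S.edge (inl x) (inr y) (glueEdge c x y)

def canonicalEdge (c : Term) : Term := glueEdge c (app S.f c) (app S.g c)

/-- The type of edges from `i` to `j`. -/
def edges (i j : Term) : Term := sig S.C fun c => fun n =>
  prod (id (sum S.A S.B) (inl (app S.f c)) i n) (id (sum S.A S.B) (inr (app S.g c)) j n)

/-- Induction over edges: it suffices to treat the edges `(c, refl, refl)`. -/
def edgeInd (G : Term → Term → Term → Term) (d : Term → Term) (i j e : Term) : Term :=
  let V := sum S.A S.B
  app (app (app (app (app
    -- Motive and case are abstracted as variables, so the nested eliminations are checked for a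
    -- generic `G` valued in the universe instead of the expanded motive.
    (lam (pi V fun i => pi V fun j => arrow (S.edges i j) univ) fun G =>
      let G (i j e : Term) : Term := app (app (app G i) j) e
      lam (pi S.C fun c => G (inl (app S.f c)) (inr (app S.g c)) (S.canonicalEdge c)) fun d =>
      lam V fun i => lam V fun j => lam (S.edges i j) fun e =>
      sigInd (G i j)
        (fun c w => sigInd (fun w => G i j (pair c w))
          (fun α β => idInd (fun i α => G i j (pair c (pair α β)))
            (idInd (fun j β => G (inl (app S.f c)) j (pair c (pair (refl (inl (app S.f c))) β)))
              (app d c) β) α) w) e)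
    (lam V fun i => lam V fun j => lam (S.edges i j) fun e => G i j e))
    (lam S.C d)) i) j) e

/-- The fiber of `inl` over `z`. -/
def fiber (z : Term) : Term := sig S.A fun a => id S.pushout (gqPt (inl a)) z

/-- The point `a` in the fiber of `inl` over `inl a`. -/
def fiberPt (a : Term) : Term := pair a (refl (gqPt (inl a)))

/-- The values of the section on vertices, given `diag b : inl b = inr b`. -/
def sectionPt (diag : Term → Term) (v : Term) : Term :=
  sumInd (fun v => S.fiber (gqPt v)) fiberPt (fun b => pair b (diag b)) v

/-- The type of the edge case in the construction of the section. -/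
def sectionEdge (diag : Term → Term) (i j e : Term) : Term :=
  id (S.fiber (gqPt j)) (tr S.fiber (S.edge i j e) (S.sectionPt diag i)) (S.sectionPt diag j)

def sectionCase (diag : Term → Term) (c : Term) : Term :=
  S.sectionEdge diag (S.left c) (S.right c) (S.canonicalEdge c)

/-- A section `Π z, fiber z`. -/
def sect (diag d : Term → Term) (z : Term) : Term :=
  gqInd S.fiber (S.sectionPt diag) (S.edgeInd (S.sectionEdge diag) d) z

/-- Transport of the point `a` along `g : inl a = z` is `(a, g)`. -/
def fiberTr (a g : Term) : Term :=
  idInd (fun z g => id (S.fiber z) (tr S.fiber g (fiberPt a)) (pair a g))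
    (refl (fiberPt a)) g

/-- `inl` is an equivalence, by a section whose first component is a retraction. -/
def isEquivInl (diag d : Term → Term) : Term :=
  app
    (lam
      (sig (pi S.pushout S.fiber) fun s => pi S.A fun a =>
        id S.A (fst S.A (app s (gqPt (inl a)))) a)
      fun k => sigInd (fun _ => isEquiv S.A S.pushout fun n => pushoutInl (S.A n))
        (fun s η =>
          let g := lam S.pushout fun z => fst S.A (app s z)
          pair (pair g (lam S.A (app η)))
            (pair g (lam S.pushout fun z =>
              snd S.A (fun a => id S.pushout (gqPt (inl a)) z) (app s z)))) k)
    -- `refl` suffices for the retraction because the section computes to `(a, refl)` at `inl a`.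
    -- Abstracting over this pair as `k` keeps the section opaque above.
    (pair (lam S.pushout (S.sect diag d)) (lam S.A refl))

end Span

/-! ### Mere propositions are the canonical idempotents -/

namespace JoinType

def span (P : Term) : Span where
  C := fun n => prod (P n) (P n)
  A := P
  B := P
  f := lam (fun n => prod (P n) (P n)) fun c => fst P c
  g := lam (fun n => prod (P n) (P n)) fun c => sigInd (fun _ => P) (fun _ b => b) c

def glue (P x y : Term) : Term := (span P).glue (pair x y) x y

def diag (P b : Term) : Term := glue P b b

/-- The edge case of the section, given `H : isProp P`. -/
def edgeCase (P H c : Term) : Term :=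
  let S := span P
  sigInd (S.sectionCase (diag P))
    -- At `c = (a, b)` the projections compute, so the goal compares the transport of `(a, refl)`
    -- along `glue a b` with `(b, diag b)`. Induction on `H a b : a = b` leaves the diagonal edge,
    -- settled by `fiberTr`.
    (fun a b => idInd
      (fun b' _ => id (S.fiber (gqPt (inr b'))) (tr S.fiber (glue P a b') (Span.fiberPt a))
        (pair b' (diag P b')))
      (S.fiberTr a (diag P a)) (app (app H a) b)) c

def isEquivInl (P H : Term) : Term := (span P).isEquivInl (diag P) (edgeCase P H)

/-- Applying the retraction `g` to `glue x y` and to `glue y y` shows that `g (inr y)` equals both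
`x` and `y`. Each use is a transport of the homotopy `η` along the glue path. -/
def isPropOfIsEquiv (P H : Term) : Term :=
  sigInd (fun _ => isProp P)
    (fun l _ => sigInd (fun _ => isProp P)
      (fun g η => lam P fun x => lam P fun y =>
        idInd (fun x' _ => id P x' y)
          (idInd (fun w _ => id P (app g w) y) (app η y) (diag P y))
          (idInd (fun w _ => id P (app g w) x) (app η x) (glue P x y))) l) H

def proof : Term :=
  lam univ fun P =>
    pair (lam (isProp P) fun H => isEquivInl P H)
      (lam (fun n => isCanonicalIdempotentType (P n)) fun H => isPropOfIsEquiv P H)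

end JoinType

/-! ### Embeddings are the canonical idempotents -/

namespace JoinMap

def span (A X f : Term) : Span where
  C := fun n => pullback (A n) (A n) (X n) (f n) (f n)
  A := A
  B := A
  f := fun n => pullbackFst (A n) (A n) (X n) (f n) (f n)
  g := fun n => pullbackSnd (A n) (A n) (X n) (f n) (f n)

def glue (A X f a b p : Term) : Term := (span A X f).glue (pair a (pair b p)) a b

def diag (A X f b : Term) : Term := glue A X f b b (refl (app f b))

/-- The edge case of the section, given `H : isEmb f`. -/
def edgeCase (A X f H c : Term) : Term :=
  let S := span A X f
  let G := S.sectionCase (diag A X f)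
  sigInd G
    (fun a w => sigInd (fun w => G (pair a w))
      -- `H` gives a path from `(b, refl)` to `(a, p)` in the fiber of `f` over `f b`. The motive is
      -- stated for a general point `v` of that fiber through its projections, so at `(b, refl)` it
      -- computes to the diagonal case.
      (fun b p => idInd
        (fun v _ =>
          let a' := fst A v
          let p' := snd A (fun a => id X (app f a) (app f b)) v
          id (S.fiber (gqPt (inr b))) (tr S.fiber (glue A X f a' b p') (Span.fiberPt a'))
            (pair b (diag A X f b)))
        (S.fiberTr b (diag A X f b))
        (app (app (app H (app f b)) (pair b (refl (app f b)))) (pair a p))) w) c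

def isEquivInl (A X f H : Term) : Term :=
  (span A X f).isEquivInl (diag A X f) (edgeCase A X f H)

/-- For `F : J → X`, `g : s = t` and `w : F s = F t` such that the action of `F` on `g` is `w`,
the elements `(s, w)` and `(t, refl)` of the fiber of `F` over `F t` agree. -/
def fiberPath : Term :=
  lam univ fun J => lam univ fun X => lam (arrow J X) fun F => lam J fun s => lam J fun t =>
  lam (id J s t) fun g => lam (id X (app F s) (app F t)) fun w =>
  -- This unfolds the action of `F` on `g` in the form in which `gqComp` delivers it. At `g = refl`
  -- the type reduces to `refl = w`, so after inducting on `g` a second induction, on `w'`,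
  -- finishes.
  let action (t g w : Term) : Term :=
    id (id X (tr (fun _ => X) g (app F s)) (app F t))
      (idInd (fun y p => id X (tr (fun _ => X) p (app F s)) (app F y)) (refl (app F s)) g)
      (trConst X g (app F s) (app F t) w)
  let fiber (x : Term) : Term := sig J fun z => id X (app F z) x
  lam (action t g w) fun w' =>
  app (app
    (idInd
      (fun t g => pi (id X (app F s) (app F t)) fun w => arrow (action t g w) <|
        id (fiber (app F t)) (pair s w) (pair t (refl (app F t))))
      (lam (id X (app F s) (app F s)) fun w =>
        lam (id (id X (app F s) (app F s)) (refl (app F s)) w) fun w' =>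
        idInd (fun w _ => id (fiber (app F s)) (pair s w) (pair s (refl (app F s))))
          (refl (pair s (refl (app F s)))) w')
      g) w) w'

/-- The join `f * f`, on vertices. -/
def joinPt (X f v : Term) : Term := sumInd (fun _ => X) (app f) (app f) v

/-- The glue path of `(a, b, p)` is sent to `p`. `trConst` converts this path in `X` into the
transported form that the constant motive demands. -/
def joinEdge (A X f i j e : Term) : Term :=
  let S := span A X f
  let F := joinPt X f
  let G (c : Term) : Term := id X (app f (app S.f c)) (app f (app S.g c))
  trConst X (S.edge i j e) (F i) (F j)
    (S.edgeInd (fun i j _ => id X (F i) (F j))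
      (sigInd G fun a w => sigInd (fun w => G (pair a w)) (fun _ p => p) w) i j e)

/-- The map `f * f`. -/
def join (A X f : Term) : Term :=
  lam (span A X f).pushout fun z =>
    gqInd (fun _ => X) (joinPt X f) (joinEdge A X f) z

/-- `(inl a, p) = (inr b, q)` in the fiber of `f * f` over `x`. -/
def fiberGlue (A X f a p b q : Term) : Term :=
  let J := (span A X f).pushout
  let F := join A X f
  let l := gqPt (inl a)
  let r := gqPt (inr b)
  app (idInd
    (fun x q => pi (id X (app f a) x) fun p =>
      id (sig J fun z => id X (app F z) x) (pair l p) (pair r q))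
    (lam (id X (app f a) (app f b)) fun p =>
      app (app (app (app (app (app (app (app fiberPath J) X) F) l) r) (glue A X f a b p)) p)
        -- After induction on `q` the point `x` is `f b` and `p : f a = f b`. On an edge with two
        -- `refl` components `joinEdge` reduces to `trConst` of `p`, so the computation rule says
        -- that `f * f` acts on the glue path as `p`.
        (gqComp (fun _ => X) (joinPt X f) (joinEdge A X f)
          (app (lam J fun _ => inl a) l) (inr b)
          (Span.glueEdge (pair a (pair b p)) a b))) q) p

/-- Equivalences `e : A ≃ B` are injective on the fibers of maps `F : B → X`. -/
def Injective (A X B e : Term) : Term :=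
  pi (arrow B X) fun F => pi X fun x =>
  let i (a : Term) : Term := app (fst (arrow A B) e) a
  let fiber : Term := sig B fun z => id X (app F z) x
  pi A fun a => pi (id X (app F (i a)) x) fun p =>
  pi A fun a' => pi (id X (app F (i a')) x) fun p' =>
  pi fiber fun w => arrow (id fiber (pair (i a) p) w) <| arrow (id fiber (pair (i a') p') w) <|
  id (sig A fun a => id X (app F (i a)) x) (pair a p) (pair a' p')

/-- For the identity equivalence the two fibers coincide by computation, and the claim is the
composite of `r` with the inverse of `r'`. -/
def injectiveId (A X : Term) : Term :=
  lam (arrow A X) fun F => lam X fun x =>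
  let fiber : Term := sig A fun z => id X (app F z) x
  lam A fun a => lam (id X (app F a) x) fun p =>
  lam A fun a' => lam (id X (app F a') x) fun p' =>
  lam fiber fun w => lam (id fiber (pair a p) w) fun r => lam (id fiber (pair a' p') w) fun r' =>
  app (idInd (fun w _ => arrow (id fiber (pair a p) w) (id fiber (pair a p) (pair a' p')))
    (lam (id fiber (pair a p) (pair a' p')) fun r => r) r') r

/-- By univalence, it suffices to treat the identity. -/
def injective (A X B e : Term) : Term :=
  sigInd (fun _ => Injective A X B e)
    (fun _ r => sigInd (fun _ => Injective A X B e)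
      -- `ε e` identifies `e` with `idToEquiv (h e)`. Path induction on `h e : A = B` then makes `B`
      -- equal to `A`, where `idToEquiv` computes to the identity equivalence.
      (fun h ε => idInd (fun e _ => Injective A X B e)
        (idInd (fun B p => Injective A X B (app (idToEquiv A B) p)) (injectiveId A X) (app h e))
        (app ε e)) r)
    (ann (isEquiv (id univ A B) (equiv A B) (idToEquiv A B)) (ua A B))

/-- Injectivity of `inl` on fibers is applied with the common point `(inr b, q)`, which `k` joins to
`(inl a, p)` and to `(inl b, q)`. The fibers match because `f * f` computes to `f` on `inl`. The
instance for `b` uses the glue path over the diagonal. -/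
def isEmbOfIsEquiv (A X f H : Term) : Term :=
  let J := (span A X f).pushout
  let F := join A X f
  app
    (lam
      (pi X fun x => pi A fun a => pi (id X (app f a) x) fun p =>
        pi A fun b => pi (id X (app f b) x) fun q =>
        id (sig J fun z => id X (app F z) x) (pair (gqPt (inl a)) p) (pair (gqPt (inr b)) q))
      fun k => lam X fun x => lam (fib A X f x) fun u => lam (fib A X f x) fun v =>
        sigInd (fun u => id (fib A X f x) u v)
          (fun a p => sigInd (fun v => id (fib A X f x) (pair a p) v)
            (fun b q =>
              let inj := app (lam (equiv A J) fun e => injective A X J e)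
                (pair (fun n => pushoutInl (A n)) H)
              let glue (a p : Term) : Term := app (app (app (app (app k x) a) p) b) q
              app (app (app (app (app (app (app (app (app inj F) x) a) p) b) q)
                (pair (gqPt (inr b)) q)) (glue a p)) (glue b q)) v) u)
    (lam X fun x => lam A fun a => lam (id X (app f a) x) fun p =>
      lam A fun b => lam (id X (app f b) x) fun q => fiberGlue A X f a p b q)

def proof : Term :=
  lam univ fun A => lam univ fun X => lam (arrow A X) fun f =>
    pair (lam (isEmb A X f) fun H => isEquivInl A X f H)
      (lam (fun n => isCanonicalIdempotentMap (A n) (X n) (f n)) fun H =>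
        isEmbOfIsEquiv A X f H)

end JoinMap

end Term
end MLTT

/-! ### Kernel evaluation of the checker on the two proof terms. -/

namespace MLTT

set_option maxHeartbeats 4000000 in
theorem hasClosedTerm_embedding_iff : HasClosedTerm
    (.pi U <| .pi U <| .pi (arrow (.var 1) (.var 0)) <|
      iff (isEmb (.var 2) (.var 1) (.var 0))
        (isCanonicalIdempotentMap (.var 2) (.var 1) (.var 0))) :=
  -- The argument `0` is the length of the empty context, at which the named-variable term becomes a
  -- closed de Bruijn term. The same holds for the second proof term.
  hasClosedTerm_of_check (t := Term.JoinMap.proof 0) (by decide +kernel) (by decide +kernel)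

set_option maxHeartbeats 4000000 in
theorem hasClosedTerm_proposition_iff : HasClosedTerm
    (.pi U <| iff (isProp (.var 0)) (isCanonicalIdempotentType (.var 0))) :=
  hasClosedTerm_of_check (t := Term.JoinType.proof 0) (by decide +kernel) (by decide +kernel)

end MLTT

/-- In type theory, for all `A X : 𝒰` and `f : A → X`, the map `f` is an embedding if and only if
it is a canonical idempotent for the join of maps; and for all `P : 𝒰`, the type `P` is a mere
proposition if and only if it is a canonical idempotent for the join of types. -/
theorem mainTheorem4 :
    MLTT.HasClosedTerm
      (.pi MLTT.U <| .pi MLTT.U <| .pi (MLTT.arrow (.var 1) (.var 0)) <|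
        MLTT.iff (MLTT.isEmb (.var 2) (.var 1) (.var 0))
          (MLTT.isCanonicalIdempotentMap (.var 2) (.var 1) (.var 0))) ∧
    MLTT.HasClosedTerm
      (.pi MLTT.U <|
        MLTT.iff (MLTT.isProp (.var 0)) (MLTT.isCanonicalIdempotentType (.var 0))) :=
  ⟨MLTT.hasClosedTerm_embedding_iff, MLTT.hasClosedTerm_proposition_iff⟩
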